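/- **Setting.** Algebras are associative algebras over $\mathbb C$, possibly without unit, with non-degenerate product ($ab=0$ for all $b$ implies $a=0$, and $ba=0$ for all $b$ implies $a=0$). $M(A)$ is the algebra of two-sided multipliers of $A$, and $A'$ is the linear dual of $A$. An *algebraic quantum hypergroup* is a pair $(A,\Delta)$ of such an algebra and a linear map $\Delta:A\to M(A\otimes A)$ (not necessarily multiplicative) such that: * $\Delta(a)(1\otimes b)$, $\Delta(a)(b\otimes 1)$, $(b\otimes 1)\Delta(a)$, $(1\otimes b)\Delta(a)$ lie in $A\otimes A$, and $(a\otimes1\otimes1)(\Delta\otimes\iota)(\Delta(b)(1\otimes c))=(\iota\otimes\Delta)((a\otimes1)\Delta(b))(1\otimes1\otimes c)$ for all $a,b,c\in A$; * there is a counit: a homomorphism $\varepsilon:A\to\mathbb C$ with $(\varepsilon\otimes\iota)\Delta(a)=a=(\iota\otimes\varepsilon)\Delta(a)$; * there is a faithful left integral: a non-zero $\varphi\in A'$ with $(\iota\otimes\varphi)\Delta(a)=\varphi(a)1$ in $M(A)$, such that $\varphi(ab)=0$ for all $b$, or $\varphi(ba)=0$ for all $b$, implies $a=0$; * there is an antipode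 relative to $\varphi$: a bijective linear anti-homomorphism $S:A\to A$ with $S((\iota\otimes\varphi)(\Delta(a)(1\otimes b)))=(\iota\otimes\varphi)((1\otimes a)\Delta(b))$. Fix $\varepsilon,\varphi,S$ and put $\psi=\varphi\circ S$. The *modular element* is the invertible $\delta\in M(A)$ with $(\varphi\otimes\iota)\Delta(a)=\varphi(a)\delta$, $(\iota\otimes\psi)\Delta(a)=\psi(a)\delta^{-1}$ and $\varphi(S(a))=\varphi(a\delta)$. The *modular automorphisms* are the algebra automorphisms $\sigma,\sigma'$ of $A$ with $\varphi(ab)=\varphi(b\sigma(a))$ and $\psi(ab)=\psi(b\sigma'(a))$. The *dual* $(\widehat A,\widehat\Delta)$ has $\widehat A=\{\varphi(\,\cdot\,a)\mid a\in A\}\subseteq A'$ with product $(\omega\omega')(x)=(\omega\otimes\omega')\Delta(x)$, and comultiplication given by $$\langle(\omega_1\otimes1)\widehat\Delta(\omega_2),x\otimes y\rangle=\langle\omega_1\otimes\omega_2,\Delta(x)(1\otimes y)\rangle,\qquad \langle\widehat\Delta(\omega_1)(1\otimes\omega_2),x\otimes y\rangle=\langle\omega_1\otimes\omega_2,(x\otimes1)\Delta(y)\rangle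 .$$ Its counit is $\widehat\varepsilon(\varphi(\,\cdot\,a))=\varphi(a)$, its left integral is normalized by $\widehat\varphi(\psi(a\,\cdot\,))=\varepsilon(a)$, its antipode is $\widehat S(\omega)=\omega\circ S$, and $\widehat\psi=\widehat\varphi\circ\widehat S$. A multiplier $m\in M(\widehat A)$ is identified with the functional $f\in A'$ for which $m\omega=(f\otimes\omega)\circ\Delta$ and $\omega m=(\omega\otimes f)\circ\Delta$ for all $\omega\in\widehat A$. **Proposition 4.1.** Let $(A,\Delta)$ be an algebraic quantum hypergroup. The objects $\delta,\sigma,\sigma'$ exist and are unique, the dual is an algebraic quantum hypergroup, uniquely determined by the above formulas, and its modular element $\widehat\delta$ and modular automorphisms $\widehat\sigma,\widehat\sigma'$ (associated with $\widehat\varphi,\widehat\psi$) likewise exist and are unique. As linear functionals on $A$, $$\widehat\delta=\varepsilon\circ\sigma^{-1}=\varepsilon\circ\sigma'^{-1},\qquad \widehat\delta^{-1}=\varepsilon\circ\sigma=\varepsilon\circ\sigma'.$$ Moreover, for all $a\in A$ and $\omega\in\widehat A$, $$\langle\widehat\sigma(\omega),a\rangle=\langle\omega,S^2(a)\delta^{-1}\rangle,\qquad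 \langle\widehat\sigma'(\omega),a\rangle=\langle\omega,\delta^{-1}S^{-2}(a)\rangle.$$ -/

import Mathlib

open scoped TensorProduct

universe u

noncomputable section

/-- The product of `A` is non-degenerate. -/
class NondegMul (A : Type*) [NonUnitalRing A] : Prop where
  left : ∀ a : A, (∀ b, a * b = 0) → a = 0
  right : ∀ a : A, (∀ b, b * a = 0) → a = 0

section Multipliers

variable (A : Type*) [NonUnitalRing A] [Module ℂ A] [IsScalarTower ℂ A A] [SMulCommClass ℂ A A]

/-- The two-sided multipliers `m` of `A`, as pairs of the maps `a ↦ m a` and `a ↦ a m`. -/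
def multiplierSubalgebra : Subalgebra ℂ (Module.End ℂ A × (Module.End ℂ A)ᵐᵒᵖ) where
  carrier := {m | (∀ a b, m.1 (a * b) = m.1 a * b) ∧
    (∀ a b, m.2.unop (a * b) = a * m.2.unop b) ∧ ∀ a b, m.2.unop a * b = a * m.1 b}
  mul_mem' := by
    rintro m n ⟨h1, h2, h3⟩ ⟨k1, k2, k3⟩
    refine ⟨fun a b => ?_, fun a b => ?_, fun a b => ?_⟩
    · simp [h1, k1]
    · simp [h2, k2]
    · simp [h3, k3]
  add_mem' := by
    rintro m n ⟨h1, h2, h3⟩ ⟨k1, k2, k3⟩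
    refine ⟨fun a b => ?_, fun a b => ?_, fun a b => ?_⟩
    · simp [h1, k1, add_mul]
    · simp [h2, k2, mul_add]
    · simp [h3, k3, mul_add, add_mul]
  algebraMap_mem' := by
    intro r
    refine ⟨fun a b => ?_, fun a b => ?_, fun a b => ?_⟩ <;>
      simp [Module.algebraMap_end_apply, smul_mul_assoc, mul_smul_comm]

/-- The multiplier algebra `M(A)`. -/
abbrev Multiplier : Type _ := ↥(multiplierSubalgebra A)

end Multipliers

namespace Multiplier

variable {A : Type*} [NonUnitalRing A] [Module ℂ A] [IsScalarTower ℂ A A] [SMulCommClass ℂ A A]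

/-- `m.lmul a` is `m a`. -/
def lmul (m : Multiplier A) : A →ₗ[ℂ] A := m.1.1

/-- `m.rmul a` is `a m`. -/
def rmul (m : Multiplier A) : A →ₗ[ℂ] A := m.1.2.unop

theorem lmul_mul (m : Multiplier A) (a b : A) : m.lmul (a * b) = m.lmul a * b := m.2.1 a b

theorem rmul_mul (m : Multiplier A) (a b : A) : m.rmul (a * b) = a * m.rmul b := m.2.2.1 a b

theorem rmul_mul_eq (m : Multiplier A) (a b : A) : m.rmul a * b = a * m.lmul b := m.2.2.2 a b

theorem ext' {m n : Multiplier A} (h1 : ∀ a, m.lmul a = n.lmul a)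
    (h2 : ∀ a, m.rmul a = n.rmul a) : m = n :=
  Subtype.ext (Prod.ext (LinearMap.ext h1) (MulOpposite.unop_injective (LinearMap.ext h2)))

/-- The embedding of `A` in `M(A)`. -/
def ofElem : A →ₗ[ℂ] Multiplier A where
  toFun a := ⟨(LinearMap.mulLeft ℂ a, MulOpposite.op (LinearMap.mulRight ℂ a)),
    fun b c => by simp [mul_assoc], fun b c => by simp [mul_assoc],
    fun b c => by simp [mul_assoc]⟩
  map_add' a b := ext' (fun c => add_mul a b c) (fun c => mul_add c a b)
  map_smul' r a := ext' (fun c => smul_mul_assoc r a c) (fun c => mul_smul_comm r c a)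

theorem ofElem_mul (a : A) (m : Multiplier A) : ofElem a * m = ofElem (m.rmul a) :=
  ext' (fun b => (m.rmul_mul_eq a b).symm) (fun b => m.rmul_mul b a)

theorem mul_ofElem (a : A) (m : Multiplier A) : m * ofElem a = ofElem (m.lmul a) :=
  ext' (fun b => m.lmul_mul a b) (fun b => m.rmul_mul_eq b a)

theorem ofElem_injective [NondegMul A] : Function.Injective (ofElem (A := A)) := by
  rw [injective_iff_map_eq_zero]
  intro a ha
  refine NondegMul.left a fun b => ?_
  have : (ofElem a).lmul b = (0 : Multiplier A).lmul b := by rw [ha]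
  exact this

/-- A bilinear map with values in `A ⊆ M(A)`, regarded as a bilinear map to `A`. -/
def restrict₂ [NondegMul A] {V W : Type*} [AddCommGroup V] [Module ℂ V] [AddCommGroup W]
    [Module ℂ W] (f : V →ₗ[ℂ] W →ₗ[ℂ] Multiplier A) (h : ∀ v w, ∃ a, f v w = ofElem a) :
    V →ₗ[ℂ] W →ₗ[ℂ] A :=
  have hc : ∀ v w, ofElem (h v w).choose = f v w := fun v w => (h v w).choose_spec.symm
  LinearMap.mk₂ ℂ (fun v w => (h v w).choose)
    (fun v v' w => ofElem_injective ((hc _ _).trans (by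
      rw [ofElem.map_add, hc, hc, f.map_add, LinearMap.add_apply])))
    (fun c v w => ofElem_injective ((hc _ _).trans (by
      rw [ofElem.map_smul, hc, f.map_smul, LinearMap.smul_apply])))
    (fun v w w' => ofElem_injective ((hc _ _).trans (by
      rw [ofElem.map_add, hc, hc, (f v).map_add])))
    (fun c v w => ofElem_injective ((hc _ _).trans (by
      rw [ofElem.map_smul, hc, (f v).map_smul])))

theorem ofElem_restrict₂ [NondegMul A] {V W : Type*} [AddCommGroup V] [Module ℂ V]
    [AddCommGroup W] [Module ℂ W] (f : V →ₗ[ℂ] W →ₗ[ℂ] Multiplier A)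
    (h : ∀ v w, ∃ a, f v w = ofElem a) (v : V) (w : W) : ofElem (restrict₂ f h v w) = f v w :=
  (h v w).choose_spec.symm

/-- The multiplier `a ⊗ 1` of `A ⊗ A`. -/
def leg₁ : A →ₗ[ℂ] Multiplier (A ⊗[ℂ] A) where
  toFun a := ⟨((LinearMap.mulLeft ℂ a).rTensor A,
      MulOpposite.op ((LinearMap.mulRight ℂ a).rTensor A)), by
    refine ⟨fun s t => ?_, fun s t => ?_, fun s t => ?_⟩ <;>
    induction s with
    | zero => simp
    | add x y hx hy => simp_all [add_mul]
    | tmul p q =>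
      induction t with
      | zero => simp
      | add x y hx hy => simp_all [mul_add]
      | tmul p' q' => simp [mul_assoc]⟩
  map_add' a b := ext'
    (LinearMap.congr_fun ((LinearMap.rTensorHom A ∘ₗ LinearMap.mul ℂ A).map_add a b))
    (LinearMap.congr_fun ((LinearMap.rTensorHom A ∘ₗ (LinearMap.mul ℂ A).flip).map_add a b))
  map_smul' r a := ext'
    (LinearMap.congr_fun ((LinearMap.rTensorHom A ∘ₗ LinearMap.mul ℂ A).map_smul r a))
    (LinearMap.congr_fun ((LinearMap.rTensorHom A ∘ₗ (LinearMap.mul ℂ A).flip).map_smul r a))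

theorem lmul_leg₁ (a : A) : (leg₁ a).lmul = (LinearMap.mulLeft ℂ a).rTensor A := rfl

theorem rmul_leg₁ (a : A) : (leg₁ a).rmul = (LinearMap.mulRight ℂ a).rTensor A := rfl

/-- The multiplier `1 ⊗ a` of `A ⊗ A`. -/
def leg₂ : A →ₗ[ℂ] Multiplier (A ⊗[ℂ] A) where
  toFun a := ⟨((LinearMap.mulLeft ℂ a).lTensor A,
      MulOpposite.op ((LinearMap.mulRight ℂ a).lTensor A)), by
    refine ⟨fun s t => ?_, fun s t => ?_, fun s t => ?_⟩ <;>
    induction s with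
    | zero => simp
    | add x y hx hy => simp_all [add_mul]
    | tmul p q =>
      induction t with
      | zero => simp
      | add x y hx hy => simp_all [mul_add]
      | tmul p' q' => simp [mul_assoc]⟩
  map_add' a b := ext'
    (LinearMap.congr_fun ((LinearMap.lTensorHom A ∘ₗ LinearMap.mul ℂ A).map_add a b))
    (LinearMap.congr_fun ((LinearMap.lTensorHom A ∘ₗ (LinearMap.mul ℂ A).flip).map_add a b))
  map_smul' r a := ext'
    (LinearMap.congr_fun ((LinearMap.lTensorHom A ∘ₗ LinearMap.mul ℂ A).map_smul r a))
    (LinearMap.congr_fun ((LinearMap.lTensorHom A ∘ₗ (LinearMap.mul ℂ A).flip).map_smul r a))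

theorem lmul_leg₂ (a : A) : (leg₂ a).lmul = (LinearMap.mulLeft ℂ a).lTensor A := rfl

theorem rmul_leg₂ (a : A) : (leg₂ a).rmul = (LinearMap.mulRight ℂ a).lTensor A := rfl

end Multiplier

section Slices

variable {A : Type*} [AddCommGroup A] [Module ℂ A]

/-- The slice map `ι ⊗ f : A ⊗ A → A`. -/
def sliceR (f : Module.Dual ℂ A) : A ⊗[ℂ] A →ₗ[ℂ] A :=
  (TensorProduct.rid ℂ A).toLinearMap ∘ₗ f.lTensor A

/-- The slice map `f ⊗ ι : A ⊗ A → A`. -/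
def sliceL (f : Module.Dual ℂ A) : A ⊗[ℂ] A →ₗ[ℂ] A :=
  (TensorProduct.lid ℂ A).toLinearMap ∘ₗ f.rTensor A

@[simp] theorem sliceR_tmul (f : Module.Dual ℂ A) (p q : A) :
    sliceR f (p ⊗ₜ[ℂ] q) = f q • p := by simp [sliceR]

@[simp] theorem sliceL_tmul (f : Module.Dual ℂ A) (p q : A) :
    sliceL f (p ⊗ₜ[ℂ] q) = f p • q := by simp [sliceL]

theorem eq_zero_of_sliceL (t : A ⊗[ℂ] A) (h : ∀ f : Module.Dual ℂ A, sliceL f t = 0) :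
    t = 0 := by
  classical
  let b := Module.Basis.ofVectorSpace ℂ A
  apply (TensorProduct.equivFinsuppOfBasisLeft (N := A) b).injective
  ext i
  have h' : ∀ t : A ⊗[ℂ] A,
      TensorProduct.equivFinsuppOfBasisLeft (N := A) b t i = sliceL (b.coord i) t := by
    intro t
    induction t with
    | zero => simp
    | add x y hx hy => simp [hx, hy]
    | tmul p q => simp
  rw [h', h]
  simp

theorem eq_zero_of_sliceR (t : A ⊗[ℂ] A) (h : ∀ f : Module.Dual ℂ A, sliceR f t = 0) :
    t = 0 := by
  have h' : ∀ (f : Module.Dual ℂ A) (t : A ⊗[ℂ] A),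
      sliceL f (TensorProduct.comm ℂ A A t) = sliceR f t := by
    intro f t
    induction t with
    | zero => simp
    | add x y hx hy => simp [hx, hy]
    | tmul p q => simp
  apply (TensorProduct.comm ℂ A A).injective
  rw [map_zero]
  exact eq_zero_of_sliceL _ fun f => by rw [h', h]

end Slices

section TensorNondeg

variable {A : Type*} [NonUnitalRing A] [Module ℂ A] [IsScalarTower ℂ A A] [SMulCommClass ℂ A A]

theorem sliceR_leg₁_rmul (f : Module.Dual ℂ A) (c : A) (t : A ⊗[ℂ] A) :
    sliceR f ((Multiplier.leg₁ c).rmul t) = sliceR f t * c := by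
  induction t with
  | zero => simp
  | add x y hx hy => simp [hx, hy, add_mul]
  | tmul p q =>
    exact (by simp [smul_mul_assoc] : sliceR f ((p * c) ⊗ₜ[ℂ] q) = sliceR f (p ⊗ₜ[ℂ] q) * c)

theorem sliceR_leg₁_lmul (f : Module.Dual ℂ A) (c : A) (t : A ⊗[ℂ] A) :
    sliceR f ((Multiplier.leg₁ c).lmul t) = c * sliceR f t := by
  induction t with
  | zero => simp
  | add x y hx hy => simp [hx, hy, mul_add]
  | tmul p q =>
    exact (by simp [mul_smul_comm] : sliceR f ((c * p) ⊗ₜ[ℂ] q) = c * sliceR f (p ⊗ₜ[ℂ] q))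

theorem sliceL_leg₂_rmul (f : Module.Dual ℂ A) (c : A) (t : A ⊗[ℂ] A) :
    sliceL f ((Multiplier.leg₂ c).rmul t) = sliceL f t * c := by
  induction t with
  | zero => simp
  | add x y hx hy => simp [hx, hy, add_mul]
  | tmul p q =>
    exact (by simp [smul_mul_assoc] : sliceL f (p ⊗ₜ[ℂ] (q * c)) = sliceL f (p ⊗ₜ[ℂ] q) * c)

theorem sliceL_leg₂_lmul (f : Module.Dual ℂ A) (c : A) (t : A ⊗[ℂ] A) :
    sliceL f ((Multiplier.leg₂ c).lmul t) = c * sliceL f t := by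
  induction t with
  | zero => simp
  | add x y hx hy => simp [hx, hy, mul_add]
  | tmul p q =>
    exact (by simp [mul_smul_comm] : sliceL f (p ⊗ₜ[ℂ] (c * q)) = c * sliceL f (p ⊗ₜ[ℂ] q))

theorem mul_tmul_eq_legs (t : A ⊗[ℂ] A) (b c : A) :
    t * (b ⊗ₜ[ℂ] c) = (Multiplier.leg₁ b).rmul ((Multiplier.leg₂ c).rmul t) := by
  induction t with
  | zero => simp
  | add x y hx hy => simp only [add_mul, hx, hy, map_add]
  | tmul p q => exact Algebra.TensorProduct.tmul_mul_tmul _ _ _ _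

theorem tmul_mul_eq_legs (t : A ⊗[ℂ] A) (b c : A) :
    (b ⊗ₜ[ℂ] c) * t = (Multiplier.leg₁ b).lmul ((Multiplier.leg₂ c).lmul t) := by
  induction t with
  | zero => simp
  | add x y hx hy => simp only [mul_add, hx, hy, map_add]
  | tmul p q => exact Algebra.TensorProduct.tmul_mul_tmul _ _ _ _

instance instNondegMulTensor [NondegMul A] : NondegMul (A ⊗[ℂ] A) where
  left t h := by
    refine eq_zero_of_sliceL t fun g => NondegMul.left _ fun c => ?_
    rw [← sliceL_leg₂_rmul]
    suffices h' : (Multiplier.leg₂ c).rmul t = 0 by rw [h', map_zero]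
    refine eq_zero_of_sliceR _ fun f => NondegMul.left _ fun b => ?_
    rw [← sliceR_leg₁_rmul, ← mul_tmul_eq_legs, h, map_zero]
  right t h := by
    refine eq_zero_of_sliceL t fun g => NondegMul.right _ fun c => ?_
    rw [← sliceL_leg₂_lmul]
    suffices h' : (Multiplier.leg₂ c).lmul t = 0 by rw [h', map_zero]
    refine eq_zero_of_sliceR _ fun f => NondegMul.right _ fun b => ?_
    rw [← sliceR_leg₁_lmul, ← tmul_mul_eq_legs, h, map_zero]

end TensorNondeg

section Hypergroup

variable (A : Type*) [NonUnitalRing A] [Module ℂ A] [IsScalarTower ℂ A A] [SMulCommClass ℂ A A]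

/-- An algebra with non-degenerate product and a linear map `Δ : A → M(A ⊗ A)`, such that the
products of `Δ(a)` with `1 ⊗ b` and `b ⊗ 1` on either side lie in `A ⊗ A`. -/
structure PreComul where
  nondeg : NondegMul A
  comul : A →ₗ[ℂ] Multiplier (A ⊗[ℂ] A)
  mem_mul_leg₁ : ∀ a b, ∃ t, comul a * Multiplier.leg₁ b = Multiplier.ofElem t
  mem_mul_leg₂ : ∀ a b, ∃ t, comul a * Multiplier.leg₂ b = Multiplier.ofElem t
  mem_leg₁_mul : ∀ a b, ∃ t, Multiplier.leg₁ b * comul a = Multiplier.ofElem t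
  mem_leg₂_mul : ∀ a b, ∃ t, Multiplier.leg₂ b * comul a = Multiplier.ofElem t

namespace PreComul

variable {A}
variable (P : PreComul A)

/-- `P.comulR₁ a b` is the element `Δ(a)(b ⊗ 1)` of `A ⊗ A`. -/
def comulR₁ : A →ₗ[ℂ] A →ₗ[ℂ] A ⊗[ℂ] A :=
  haveI := P.nondeg
  Multiplier.restrict₂ ((LinearMap.mul ℂ _).compl₁₂ P.comul Multiplier.leg₁) P.mem_mul_leg₁

/-- `P.comulR₂ a b` is the element `Δ(a)(1 ⊗ b)` of `A ⊗ A`. -/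
def comulR₂ : A →ₗ[ℂ] A →ₗ[ℂ] A ⊗[ℂ] A :=
  haveI := P.nondeg
  Multiplier.restrict₂ ((LinearMap.mul ℂ _).compl₁₂ P.comul Multiplier.leg₂) P.mem_mul_leg₂

/-- `P.comulL₁ a b` is the element `(b ⊗ 1)Δ(a)` of `A ⊗ A`. -/
def comulL₁ : A →ₗ[ℂ] A →ₗ[ℂ] A ⊗[ℂ] A :=
  haveI := P.nondeg
  Multiplier.restrict₂ ((LinearMap.mul ℂ _).flip.compl₁₂ P.comul Multiplier.leg₁) P.mem_leg₁_mul

/-- `P.comulL₂ a b` is the element `(1 ⊗ b)Δ(a)` of `A ⊗ A`. -/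
def comulL₂ : A →ₗ[ℂ] A →ₗ[ℂ] A ⊗[ℂ] A :=
  haveI := P.nondeg
  Multiplier.restrict₂ ((LinearMap.mul ℂ _).flip.compl₁₂ P.comul Multiplier.leg₂) P.mem_leg₂_mul

theorem ofElem_comulR₁ (a b : A) :
    Multiplier.ofElem (P.comulR₁ a b) = P.comul a * Multiplier.leg₁ b :=
  haveI := P.nondeg
  Multiplier.ofElem_restrict₂ _ _ a b

theorem ofElem_comulR₂ (a b : A) :
    Multiplier.ofElem (P.comulR₂ a b) = P.comul a * Multiplier.leg₂ b :=
  haveI := P.nondeg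
  Multiplier.ofElem_restrict₂ _ _ a b

theorem ofElem_comulL₁ (a b : A) :
    Multiplier.ofElem (P.comulL₁ a b) = Multiplier.leg₁ b * P.comul a :=
  haveI := P.nondeg
  Multiplier.ofElem_restrict₂ _ _ a b

theorem ofElem_comulL₂ (a b : A) :
    Multiplier.ofElem (P.comulL₂ a b) = Multiplier.leg₂ b * P.comul a :=
  haveI := P.nondeg
  Multiplier.ofElem_restrict₂ _ _ a b

end PreComul

namespace Multiplier

variable {A}

theorem leg₁_mul (b c : A) : leg₁ (b * c) = leg₁ b * leg₁ c := by
  refine ext' (fun t => ?_) (fun t => ?_) <;> induction t with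
  | zero => simp
  | add x y hx hy => rw [map_add, hx, hy, map_add]
  | tmul p q => first
    | exact congrArg (· ⊗ₜ[ℂ] q) (mul_assoc b c p)
    | exact congrArg (· ⊗ₜ[ℂ] q) (mul_assoc p b c).symm

theorem leg₂_mul (b c : A) : leg₂ (b * c) = leg₂ b * leg₂ c := by
  refine ext' (fun t => ?_) (fun t => ?_) <;> induction t with
  | zero => simp
  | add x y hx hy => rw [map_add, hx, hy, map_add]
  | tmul p q => first
    | exact congrArg (p ⊗ₜ[ℂ] ·) (mul_assoc b c q)
    | exact congrArg (p ⊗ₜ[ℂ] ·) (mul_assoc q b c).symm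

theorem leg₁_mul_leg₂ (b c : A) : leg₁ b * leg₂ c = leg₂ c * leg₁ b := by
  refine ext' (fun t => ?_) (fun t => ?_) <;> induction t with
  | zero => simp
  | add x y hx hy => rw [map_add, hx, hy, map_add]
  | tmul p q => rfl

end Multiplier

namespace PreComul

variable {A}
variable (P : PreComul A)

/-- The multiplier `(ι ⊗ f)Δ(a)` of `A`: its product with `b` on the right is
`(ι ⊗ f)(Δ(a)(b ⊗ 1))`, its product with `b` on the left is `(ι ⊗ f)((b ⊗ 1)Δ(a))`. -/
def mulSliceR (f : Module.Dual ℂ A) (a : A) : Multiplier A :=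
  ⟨(sliceR f ∘ₗ P.comulR₁ a, MulOpposite.op (sliceR f ∘ₗ P.comulL₁ a)), by
    have := P.nondeg
    refine ⟨fun b c => ?_, fun b c => ?_, fun b c => ?_⟩
    · have : P.comulR₁ a (b * c) = (Multiplier.leg₁ c).rmul (P.comulR₁ a b) :=
        Multiplier.ofElem_injective (by
          rw [← Multiplier.ofElem_mul, P.ofElem_comulR₁, P.ofElem_comulR₁, Multiplier.leg₁_mul,
            mul_assoc])
      simp [this, sliceR_leg₁_rmul]
    · have : P.comulL₁ a (b * c) = (Multiplier.leg₁ b).lmul (P.comulL₁ a c) :=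
        Multiplier.ofElem_injective (by
          rw [← Multiplier.mul_ofElem, P.ofElem_comulL₁, P.ofElem_comulL₁, Multiplier.leg₁_mul,
            mul_assoc])
      simp [this, sliceR_leg₁_lmul]
    · have : (Multiplier.leg₁ c).rmul (P.comulL₁ a b) = (Multiplier.leg₁ b).lmul (P.comulR₁ a c) :=
        Multiplier.ofElem_injective (by
          rw [← Multiplier.mul_ofElem, ← Multiplier.ofElem_mul, P.ofElem_comulL₁,
            P.ofElem_comulR₁, mul_assoc])
      simp [← sliceR_leg₁_rmul, ← sliceR_leg₁_lmul, this]⟩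

/-- The multiplier `(f ⊗ ι)Δ(a)` of `A`: its product with `b` on the right is
`(f ⊗ ι)(Δ(a)(1 ⊗ b))`, its product with `b` on the left is `(f ⊗ ι)((1 ⊗ b)Δ(a))`. -/
def mulSliceL (f : Module.Dual ℂ A) (a : A) : Multiplier A :=
  ⟨(sliceL f ∘ₗ P.comulR₂ a, MulOpposite.op (sliceL f ∘ₗ P.comulL₂ a)), by
    have := P.nondeg
    refine ⟨fun b c => ?_, fun b c => ?_, fun b c => ?_⟩
    · have : P.comulR₂ a (b * c) = (Multiplier.leg₂ c).rmul (P.comulR₂ a b) :=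
        Multiplier.ofElem_injective (by
          rw [← Multiplier.ofElem_mul, P.ofElem_comulR₂, P.ofElem_comulR₂, Multiplier.leg₂_mul,
            mul_assoc])
      simp [this, sliceL_leg₂_rmul]
    · have : P.comulL₂ a (b * c) = (Multiplier.leg₂ b).lmul (P.comulL₂ a c) :=
        Multiplier.ofElem_injective (by
          rw [← Multiplier.mul_ofElem, P.ofElem_comulL₂, P.ofElem_comulL₂, Multiplier.leg₂_mul,
            mul_assoc])
      simp [this, sliceL_leg₂_lmul]
    · have : (Multiplier.leg₂ c).rmul (P.comulL₂ a b) = (Multiplier.leg₂ b).lmul (P.comulR₂ a c) :=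
        Multiplier.ofElem_injective (by
          rw [← Multiplier.mul_ofElem, ← Multiplier.ofElem_mul, P.ofElem_comulL₂,
            P.ofElem_comulR₂, mul_assoc])
      simp [← sliceL_leg₂_rmul, ← sliceL_leg₂_lmul, this]⟩

end PreComul

/-- An algebraic quantum hypergroup: an algebra with non-degenerate product and a regular
comultiplication, with its counit `ε`, a faithful left integral `φ`, and the antipode `S` relative
to `φ`. The comultiplication is not required to be multiplicative. -/
structure QuantumHypergroup extends PreComul A where
  /-- `(a ⊗ 1 ⊗ 1)(Δ ⊗ ι)(Δ(b)(1 ⊗ c)) = (ι ⊗ Δ)((a ⊗ 1)Δ(b))(1 ⊗ 1 ⊗ c)` in `A ⊗ A ⊗ A` -/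
  coassoc : ∀ a b c, TensorProduct.assoc ℂ A A A
      ((toPreComul.comulL₁.flip a).rTensor A (toPreComul.comulR₂ b c)) =
    (toPreComul.comulR₂.flip c).lTensor A (toPreComul.comulL₁ b a)
  ε : A →ₙₐ[ℂ] ℂ
  counit_left : ∀ a, toPreComul.mulSliceL (ε : A →ₗ[ℂ] ℂ) a = Multiplier.ofElem a
  counit_right : ∀ a, toPreComul.mulSliceR (ε : A →ₗ[ℂ] ℂ) a = Multiplier.ofElem a
  φ : Module.Dual ℂ A
  φ_ne_zero : φ ≠ 0
  φ_left_invariant : ∀ a, toPreComul.mulSliceR φ a = φ a • (1 : Multiplier A)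
  φ_faithful_left : ∀ a, (∀ b, φ (a * b) = 0) → a = 0
  φ_faithful_right : ∀ a, (∀ b, φ (b * a) = 0) → a = 0
  S : A ≃ₗ[ℂ] A
  S_mul : ∀ a b, S (a * b) = S b * S a
  /-- `S((ι ⊗ φ)(Δ(a)(1 ⊗ b))) = (ι ⊗ φ)((1 ⊗ a)Δ(b))` -/
  S_slice : ∀ a b, S (sliceR φ (toPreComul.comulR₂ a b)) = sliceR φ (toPreComul.comulL₂ b a)

namespace QuantumHypergroup

variable {A}
variable (H : QuantumHypergroup A)

/-- The right integral `ψ = φ ∘ S`. -/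
def ψ : Module.Dual ℂ A := H.φ ∘ₗ H.S.toLinearMap

/-- The modular element `δ`, and the modular automorphisms `σ` of `φ` and `σ'` of `ψ`. -/
@[ext] structure ModularData where
  δ : (Multiplier A)ˣ
  φ_slice : ∀ a, H.mulSliceL H.φ a = H.φ a • (δ : Multiplier A)
  ψ_slice : ∀ a, H.mulSliceR H.ψ a = H.ψ a • ((δ⁻¹ : (Multiplier A)ˣ) : Multiplier A)
  φ_S : ∀ a, H.φ (H.S a) = H.φ ((δ : Multiplier A).rmul a)
  σ : A ≃ₗ[ℂ] A
  σ_mul : ∀ a b, σ (a * b) = σ a * σ b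
  φ_mul : ∀ a b, H.φ (a * b) = H.φ (b * σ a)
  σ' : A ≃ₗ[ℂ] A
  σ'_mul : ∀ a b, σ' (a * b) = σ' a * σ' b
  ψ_mul : ∀ a b, H.ψ (a * b) = H.ψ (b * σ' a)

/-- The linear map `a ↦ φ(· a)`. -/
def toFunctional : A →ₗ[ℂ] Module.Dual ℂ A := (LinearMap.mul ℂ A).flip.compr₂ H.φ

theorem toFunctional_apply (a x : A) : H.toFunctional a x = H.φ (x * a) := rfl

theorem toFunctional_injective : Function.Injective H.toFunctional := by
  rw [injective_iff_map_eq_zero]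
  intro a ha
  exact H.φ_faithful_right a fun b => by rw [← H.toFunctional_apply, ha]; rfl

/-- The space `Â` of functionals `φ(· a)` on `A`. -/
def dual : Submodule ℂ (Module.Dual ℂ A) := LinearMap.range H.toFunctional

/-- The linear bijection `a ↦ φ(· a)` of `A` onto `Â`. -/
def toDual : A ≃ₗ[ℂ] H.dual := LinearEquiv.ofInjective H.toFunctional H.toFunctional_injective

theorem toDual_apply (a x : A) : (H.toDual a : Module.Dual ℂ A) x = H.φ (x * a) := rfl

/-- The functional `f ω = (f ⊗ ω) ∘ Δ` for `f ∈ A'` and `ω ∈ Â`. With `ω = φ(· a)`, this is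
`x ↦ (f ⊗ φ)(Δ(x)(1 ⊗ a))`. -/
def leftConv (f : Module.Dual ℂ A) (ω : H.dual) : Module.Dual ℂ A :=
  f ∘ₗ sliceR H.φ ∘ₗ H.comulR₂.flip (H.toDual.symm ω)

/-- The functional `ω f = (ω ⊗ f) ∘ Δ` for `ω ∈ Â` and `f ∈ A'`. With `ω = φ(· a)`, this is
`x ↦ (φ ⊗ f)(Δ(x)(a ⊗ 1))`. -/
def rightConv (ω : H.dual) (f : Module.Dual ℂ A) : Module.Dual ℂ A :=
  f ∘ₗ sliceL H.φ ∘ₗ H.comulR₁.flip (H.toDual.symm ω)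

theorem leftConv_toDual (f : Module.Dual ℂ A) (a x : A) :
    H.leftConv f (H.toDual a) x = f (sliceR H.φ (H.comulR₂ x a)) := by
  simp [leftConv]

theorem leftConv_mem_dual (ω ω' : H.dual) : H.leftConv ω ω' ∈ H.dual := by
  obtain ⟨c, rfl⟩ := H.toDual.surjective ω
  obtain ⟨a, rfl⟩ := H.toDual.surjective ω'
  have := H.nondeg
  refine ⟨sliceL (H.φ ∘ₗ H.S.symm.toLinearMap) (H.comulL₁ a (H.S c)), ?_⟩
  ext x
  rw [leftConv_toDual, toDual_apply, toFunctional_apply]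
  have h1 : sliceR H.φ (H.comulR₂ x a) * c = H.S.symm (H.S c * sliceR H.φ (H.comulL₂ a x)) := by
    rw [← H.S_slice, ← H.S_mul, LinearEquiv.symm_apply_apply]
  have h2 : (Multiplier.leg₁ (H.S c)).lmul (H.comulL₂ a x) =
      (Multiplier.leg₂ x).lmul (H.comulL₁ a (H.S c)) :=
    Multiplier.ofElem_injective (by
      rw [← Multiplier.mul_ofElem, ← Multiplier.mul_ofElem, H.ofElem_comulL₁, H.ofElem_comulL₂,
        ← mul_assoc, ← mul_assoc, Multiplier.leg₁_mul_leg₂])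
  have h3 : ∀ (f g : Module.Dual ℂ A) (t : A ⊗[ℂ] A), f (sliceR g t) = g (sliceL f t) := by
    intro f g t
    induction t with
    | zero => simp
    | add x y hx hy => simp [hx, hy]
    | tmul p q => simp [mul_comm]
  rw [h1, ← sliceR_leg₁_lmul, h2, ← sliceL_leg₂_lmul]
  exact (h3 (H.φ ∘ₗ H.S.symm.toLinearMap) H.φ _).symm

/-- The product of `Â`: `(ω ω')(x) = (ω ⊗ ω')(Δ(x))`. -/
instance instMulDual : Mul H.dual := ⟨fun ω ω' => ⟨H.leftConv ω ω', H.leftConv_mem_dual ω ω'⟩⟩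

theorem coe_mul (ω ω' : H.dual) :
    ((ω * ω' : H.dual) : Module.Dual ℂ A) = H.leftConv ω ω' := rfl

theorem mul_toDual_apply (ω : H.dual) (a x : A) :
    ((ω * H.toDual a : H.dual) : Module.Dual ℂ A) x =
      (ω : Module.Dual ℂ A) (sliceR H.φ (H.comulR₂ x a)) :=
  H.leftConv_toDual _ a x

/-- `d * (ι ⊗ φ(· a))(Δ(x)) = (ι ⊗ φ(· a))((d ⊗ 1)Δ(x))` -/
theorem mul_sliceR_comulR₂ (d a x : A) : d * sliceR H.φ (H.comulR₂ x a) =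
    sliceR (H.toDual a : Module.Dual ℂ A) (H.comulL₁ x d) := by
  have := H.nondeg
  have h2 : (Multiplier.leg₁ d).lmul (H.comulR₂ x a) =
      (Multiplier.leg₂ a).rmul (H.comulL₁ x d) :=
    Multiplier.ofElem_injective (by
      rw [← Multiplier.mul_ofElem, ← Multiplier.ofElem_mul, H.ofElem_comulL₁, H.ofElem_comulR₂,
        mul_assoc])
  rw [← sliceR_leg₁_lmul, h2]
  generalize H.comulL₁ x d = t
  induction t with
  | zero => simp
  | add x y hx hy => simp [hx, hy]
  | tmul p q =>
    exact (by simp [toDual_apply] :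
      sliceR H.φ (p ⊗ₜ[ℂ] (q * a)) = sliceR (H.toDual a : Module.Dual ℂ A) (p ⊗ₜ[ℂ] q))

theorem dual_mul_assoc (ω₁ ω₂ ω₃ : H.dual) : ω₁ * ω₂ * ω₃ = ω₁ * (ω₂ * ω₃) := by
  have := H.nondeg
  obtain ⟨a, rfl⟩ := H.toDual.surjective ω₂
  obtain ⟨c, rfl⟩ := H.toDual.surjective ω₃
  obtain ⟨e, he⟩ := H.toDual.surjective (H.toDual a * H.toDual c)
  rw [← he]
  ext x
  rw [mul_toDual_apply, mul_toDual_apply, mul_toDual_apply]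
  congr 1
  rw [← sub_eq_zero]
  refine NondegMul.right _ fun d => ?_
  rw [mul_sub, sub_eq_zero, mul_sliceR_comulR₂, mul_sliceR_comulR₂, he]
  let g : Module.Dual ℂ A := H.toDual a
  let F : A ⊗[ℂ] (A ⊗[ℂ] A) →ₗ[ℂ] A :=
    (TensorProduct.rid ℂ A).toLinearMap ∘ₗ (g ∘ₗ sliceR H.φ).lTensor A
  have hF : ∀ (s : A ⊗[ℂ] A) (q : A),
      F (TensorProduct.assoc ℂ A A A (s ⊗ₜ[ℂ] q)) = H.φ q • sliceR g s := by
    intro s q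
    induction s with
    | zero => simp
    | add y z hy hz => simp only [TensorProduct.add_tmul, map_add, hy, hz, smul_add]
    | tmul p r => simp [F, smul_smul]
  have h1 : ∀ t : A ⊗[ℂ] A, sliceR g (H.comulL₁ (sliceR H.φ t) d) =
      F (TensorProduct.assoc ℂ A A A ((H.comulL₁.flip d).rTensor A t)) := by
    intro t
    induction t with
    | zero => simp
    | add y z hy hz => simp only [map_add, LinearMap.add_apply, hy, hz]
    | tmul p q => rw [LinearMap.rTensor_tmul, hF]; simp
  have h2 : ∀ u : A ⊗[ℂ] A, sliceR ((H.toDual a * H.toDual c : H.dual) : Module.Dual ℂ A) u =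
      F ((H.comulR₂.flip c).lTensor A u) := by
    intro u
    induction u with
    | zero => simp
    | add y z hy hz => simp only [map_add, hy, hz]
    | tmul p q => simp [F, g, mul_toDual_apply]
  rw [h2, ← H.coassoc]
  exact h1 _

instance instNonUnitalRingDual : NonUnitalRing H.dual where
  left_distrib ω ω₁ ω₂ := Subtype.ext (LinearMap.ext fun x => by
    simp [coe_mul, leftConv])
  right_distrib ω₁ ω₂ ω := Subtype.ext (LinearMap.ext fun x => by
    simp [coe_mul, leftConv])
  zero_mul ω := Subtype.ext (LinearMap.ext fun x => by simp [coe_mul, leftConv])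
  mul_zero ω := Subtype.ext (LinearMap.ext fun x => by simp [coe_mul, leftConv])
  mul_assoc := H.dual_mul_assoc

instance instIsScalarTowerDual : IsScalarTower ℂ H.dual H.dual :=
  ⟨fun r ω ω' => Subtype.ext (LinearMap.ext fun x => by
    simp [coe_mul, leftConv])⟩

instance instSMulCommClassDual : SMulCommClass ℂ H.dual H.dual :=
  ⟨fun r ω ω' => Subtype.ext (LinearMap.ext fun x => by
    simp [coe_mul, leftConv])⟩

/-- An element of `Â ⊗ Â` as a functional on `A ⊗ A`. -/
def pairing : H.dual ⊗[ℂ] H.dual →ₗ[ℂ] Module.Dual ℂ (A ⊗[ℂ] A) :=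
  TensorProduct.dualDistrib ℂ A A ∘ₗ TensorProduct.map H.dual.subtype H.dual.subtype

theorem pairing_tmul (ω₁ ω₂ : H.dual) (x y : A) :
    H.pairing (ω₁ ⊗ₜ[ℂ] ω₂) (x ⊗ₜ[ℂ] y) =
      (ω₁ : Module.Dual ℂ A) x * (ω₂ : Module.Dual ℂ A) y := by
  simp [pairing]

/-- `D` is the dual of `H`: the algebra `Â` with the comultiplication `Δ̂`, the counit `ε̂`, the left
integral `φ̂` and the antipode `Ŝ` that are defined from the data of `H`. -/
structure IsDual (D : QuantumHypergroup H.dual) : Prop where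
  /-- `⟨(ω₁ ⊗ 1)Δ̂(ω₂), x ⊗ y⟩ = ⟨ω₁ ⊗ ω₂, Δ(x)(1 ⊗ y)⟩` -/
  comul_left : ∀ ω₁ ω₂ x y, H.pairing (D.comulL₁ ω₂ ω₁) (x ⊗ₜ[ℂ] y) =
    H.pairing (ω₁ ⊗ₜ[ℂ] ω₂) (H.comulR₂ x y)
  /-- `⟨Δ̂(ω₁)(1 ⊗ ω₂), x ⊗ y⟩ = ⟨ω₁ ⊗ ω₂, (x ⊗ 1)Δ(y)⟩` -/
  comul_right : ∀ ω₁ ω₂ x y, H.pairing (D.comulR₂ ω₁ ω₂) (x ⊗ₜ[ℂ] y) =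
    H.pairing (ω₁ ⊗ₜ[ℂ] ω₂) (H.comulL₁ y x)
  /-- `ε̂(φ(· a)) = φ(a)` -/
  counit : ∀ a, D.ε (H.toDual a) = H.φ a
  /-- `φ̂(ψ(a ·)) = ε(a)` -/
  integral : ∀ (a : A) (ω : H.dual), (∀ x, (ω : Module.Dual ℂ A) x = H.ψ (a * x)) → D.φ ω = H.ε a
  /-- `Ŝ(ω) = ω ∘ S` -/
  antipode : ∀ (ω : H.dual) (x : A),
    (D.S ω : Module.Dual ℂ A) x = (ω : Module.Dual ℂ A) (H.S x)

/-- The multiplier `m` of `Â`, considered as a linear functional on `A`, is `f`: one has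
`m ω = f ω` and `ω m = ω f` for all `ω ∈ Â`. -/
def IsFunctional (m : Multiplier H.dual) (f : Module.Dual ℂ A) : Prop :=
  ∀ ω : H.dual, (m.lmul ω : Module.Dual ℂ A) = H.leftConv f ω ∧
    (m.rmul ω : Module.Dual ℂ A) = H.rightConv ω f

end QuantumHypergroup

end Hypergroup

end

/-! Elements of `M(A ⊗ A)` are handled through covers: multiplying one leg by an element of `A`
lands in `A ⊗ A`, and non-degeneracy cancels the factor afterwards. The second tool is density. If
`g` is faithful on the relevant side, the slices `(ι ⊗ g)(Δ(a)(1 ⊗ b))` and their mirror images span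
`A`: a functional `f` killing them makes `(f ⊗ ι)(Δ(a)(1 ⊗ e))` vanish, and applying `ε` with `ε(e)
= 1` gives `f(a) = 0`. On such slices the defining formula of `S` and coassociativity give that `S`
flips the comultiplication, so `ψ = φ ∘ S` is right invariant and satisfies its own antipode
formula.

Modular theory comes from evaluating a twice-sliced coproduct in both orders. Combining the antipode
formulas of `φ` and `ψ` shows that the functionals `φ(· c)`, `φ(a ·)`, `ψ(b ·)` and `ψ(· b)` form
the same space `Â`; this yields `σ`, and `σ' = S⁻¹σ⁻¹S`. The slices `(φ ⊗ ι)Δ(e)` and `(ι ⊗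
ψ)Δ(S⁻¹(e))`, with `φ(e) = 1`, turn `φ` into `ψ` and back when multiplied inside the integral, so
they are `δ` and `δ⁻¹`.

`Â` acts on `A` from both sides by slicing `Δ`, and these actions commute. The multiplier `Δ̂(ω)` is
`ω ∘ μ`, with `μ` the product of `A`, precomposed with the actions of `Â ⊗ Â` on `A ⊗ A`; its
coassociativity is associativity of `A`. The identity `φ̂(ψ(c ·) ω) = ω(S⁻¹(c))`
(`dualφ_leftDualψ_mul`) carries non-degeneracy of `Â`, faithfulness of `φ̂`, its antipode formula
and the computation of `σ̂`.

The slices of `Δ̂` that give `δ̂` and `δ̂⁻¹` evaluate to `ε ∘ σ'⁻¹` and `ε ∘ σ`. Since `σ'` is `σ`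
followed by conjugation with `δ`, and a character does not see conjugation, `σ` and `σ'` may be
interchanged there. The formulas for `σ̂` and `σ̂'` follow by computing `φ̂` and `ψ̂` of a product
in both orders and using `ψ = φ(· δ)`. -/

noncomputable section

/-! ### Multipliers, covers and slices. -/

namespace Multiplier

section General

variable {B : Type*} [NonUnitalRing B] [Module ℂ B] [IsScalarTower ℂ B B] [SMulCommClass ℂ B B]

theorem lmul_mul_apply (m n : Multiplier B) (a : B) : (m * n).lmul a = m.lmul (n.lmul a) := rfl

theorem rmul_mul_apply (m n : Multiplier B) (a : B) : (m * n).rmul a = n.rmul (m.rmul a) := rfl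

theorem lmul_one (a : B) : (1 : Multiplier B).lmul a = a := rfl

theorem rmul_one (a : B) : (1 : Multiplier B).rmul a = a := rfl

theorem lmul_smul (r : ℂ) (m : Multiplier B) (a : B) : (r • m).lmul a = r • m.lmul a := rfl

theorem rmul_smul (r : ℂ) (m : Multiplier B) (a : B) : (r • m).rmul a = r • m.rmul a := rfl

theorem lmul_ofElem (a b : B) : (ofElem a).lmul b = a * b := rfl

theorem rmul_ofElem (a b : B) : (ofElem a).rmul b = b * a := rfl

/-- The relation `(b m) a = b (m a)` and non-degeneracy recover the left map from the right one, so
half of a multiplier determines it. -/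
theorem ext_rmul [NondegMul B] {m n : Multiplier B} (h : ∀ a, m.rmul a = n.rmul a) : m = n := by
  refine ext' (fun a => sub_eq_zero.1 (NondegMul.right _ fun b => ?_)) h
  rw [mul_sub, ← rmul_mul_eq, ← rmul_mul_eq, h, sub_self]

theorem ext_lmul [NondegMul B] {m n : Multiplier B} (h : ∀ a, m.lmul a = n.lmul a) : m = n := by
  refine ext' h (fun a => sub_eq_zero.1 (NondegMul.left _ fun b => ?_))
  rw [sub_mul, rmul_mul_eq, rmul_mul_eq, h, sub_self]

theorem lmul_units_inv (u : (Multiplier B)ˣ) (a : B) :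
    (u : Multiplier B).lmul (((u⁻¹ : (Multiplier B)ˣ) : Multiplier B).lmul a) = a := by
  rw [← lmul_mul_apply, Units.mul_inv, lmul_one]

theorem rmul_units_inv (u : (Multiplier B)ˣ) (a : B) :
    (u : Multiplier B).rmul (((u⁻¹ : (Multiplier B)ˣ) : Multiplier B).rmul a) = a := by
  rw [← rmul_mul_apply, Units.inv_mul, rmul_one]

/-- The extension of an anti-automorphism of `B` to `M(B)`. -/
def antiMap (T : B ≃ₗ[ℂ] B) (hT : ∀ a b, T (a * b) = T b * T a) (m : Multiplier B) :
    Multiplier B :=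
  have hT' : ∀ a b, T.symm (a * b) = T.symm b * T.symm a := fun a b =>
    T.injective (by simp [hT])
  ⟨(T.toLinearMap ∘ₗ m.rmul ∘ₗ T.symm.toLinearMap,
    MulOpposite.op (T.toLinearMap ∘ₗ m.lmul ∘ₗ T.symm.toLinearMap)), by
    refine ⟨fun a b => ?_, fun a b => ?_, fun a b => ?_⟩
    · simp [hT, hT', rmul_mul]
    · simp [hT, hT', lmul_mul]
    · have := m.rmul_mul_eq (T.symm b) (T.symm a)
      apply T.symm.injective
      simp [hT', this]⟩

variable (T : B ≃ₗ[ℂ] B) (hT : ∀ a b, T (a * b) = T b * T a)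

theorem lmul_antiMap (m : Multiplier B) (a : B) :
    (antiMap T hT m).lmul a = T (m.rmul (T.symm a)) := rfl

theorem rmul_antiMap (m : Multiplier B) (a : B) :
    (antiMap T hT m).rmul a = T (m.lmul (T.symm a)) := rfl

theorem antiMap_mul (m n : Multiplier B) :
    antiMap T hT (m * n) = antiMap T hT n * antiMap T hT m := by
  refine ext' (fun a => ?_) (fun a => ?_)
  · simp [lmul_mul_apply, lmul_antiMap, rmul_mul_apply]
  · simp [lmul_mul_apply, rmul_antiMap, rmul_mul_apply]

theorem antiMap_ofElem (a : B) : antiMap T hT (ofElem a) = ofElem (T a) := by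
  refine ext' (fun b => ?_) (fun b => ?_)
  · simp [lmul_antiMap, lmul_ofElem, rmul_ofElem, hT]
  · simp [rmul_antiMap, lmul_ofElem, rmul_ofElem, hT]

end General

section Legs

variable {A : Type*} [NonUnitalRing A] [Module ℂ A] [IsScalarTower ℂ A A] [SMulCommClass ℂ A A]

@[simp] theorem leg₁_lmul_tmul (c p q : A) : (leg₁ c).lmul (p ⊗ₜ[ℂ] q) = (c * p) ⊗ₜ[ℂ] q := rfl

@[simp] theorem leg₁_rmul_tmul (c p q : A) : (leg₁ c).rmul (p ⊗ₜ[ℂ] q) = (p * c) ⊗ₜ[ℂ] q := rfl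

@[simp] theorem leg₂_lmul_tmul (c p q : A) : (leg₂ c).lmul (p ⊗ₜ[ℂ] q) = p ⊗ₜ[ℂ] (c * q) := rfl

@[simp] theorem leg₂_rmul_tmul (c p q : A) : (leg₂ c).rmul (p ⊗ₜ[ℂ] q) = p ⊗ₜ[ℂ] (q * c) := rfl

theorem eq_of_leg₁_lmul [NondegMul A] {s t : A ⊗[ℂ] A}
    (h : ∀ c, (leg₁ c).lmul s = (leg₁ c).lmul t) : s = t := by
  rw [← sub_eq_zero]
  refine eq_zero_of_sliceR _ fun f => NondegMul.right _ fun c => ?_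
  rw [← sliceR_leg₁_lmul, map_sub, h, sub_self, map_zero]

theorem eq_of_leg₂_rmul [NondegMul A] {s t : A ⊗[ℂ] A}
    (h : ∀ c, (leg₂ c).rmul s = (leg₂ c).rmul t) : s = t := by
  rw [← sub_eq_zero]
  refine eq_zero_of_sliceL _ fun f => NondegMul.left _ fun c => ?_
  rw [← sliceL_leg₂_rmul, map_sub, h, sub_self, map_zero]

/-- Covering a single leg loses nothing: slicing the other leg reduces the claim to non-degeneracy
of `A`. -/
theorem ext_leg₁_mul [NondegMul A] {m n : Multiplier (A ⊗[ℂ] A)}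
    (h : ∀ c, leg₁ c * m = leg₁ c * n) : m = n := by
  refine ext_lmul fun t => eq_of_leg₁_lmul fun c => ?_
  rw [← lmul_mul_apply, h, lmul_mul_apply]

theorem ext_mul_leg₂ [NondegMul A] {m n : Multiplier (A ⊗[ℂ] A)}
    (h : ∀ c, m * leg₂ c = n * leg₂ c) : m = n := by
  refine ext_rmul fun t => eq_of_leg₂_rmul fun c => ?_
  rw [← rmul_mul_apply, h, rmul_mul_apply]

end Legs

end Multiplier

section SliceLemmas

variable {A : Type*} [AddCommGroup A] [Module ℂ A]

theorem sliceR_sliceL_comm (f g : Module.Dual ℂ A) (t : A ⊗[ℂ] A) :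
    f (sliceR g t) = g (sliceL f t) := by
  induction t with
  | zero => simp
  | add x y hx hy => simp [hx, hy]
  | tmul p q => simp [mul_comm]

theorem sliceR_rTensor (f : Module.Dual ℂ A) (F : A →ₗ[ℂ] A) (t : A ⊗[ℂ] A) :
    sliceR f (F.rTensor A t) = F (sliceR f t) := by
  induction t with
  | zero => simp
  | add x y hx hy => simp [hx, hy]
  | tmul p q => simp

theorem sliceL_lTensor (f : Module.Dual ℂ A) (F : A →ₗ[ℂ] A) (t : A ⊗[ℂ] A) :
    sliceL f (F.lTensor A t) = F (sliceL f t) := by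
  induction t with
  | zero => simp
  | add x y hx hy => simp [hx, hy]
  | tmul p q => simp

end SliceLemmas

section SliceMul

variable {A : Type*} [NonUnitalRing A] [Module ℂ A] [IsScalarTower ℂ A A] [SMulCommClass ℂ A A]

theorem sliceR_leg₂_rmul (f : Module.Dual ℂ A) (c : A) (t : A ⊗[ℂ] A) :
    sliceR f ((Multiplier.leg₂ c).rmul t) = sliceR (f ∘ₗ LinearMap.mulRight ℂ c) t := by
  induction t with
  | zero => simp
  | add x y hx hy => simp only [map_add, hx, hy]
  | tmul p q => simp

theorem sliceR_leg₂_lmul (f : Module.Dual ℂ A) (c : A) (t : A ⊗[ℂ] A) :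
    sliceR f ((Multiplier.leg₂ c).lmul t) = sliceR (f ∘ₗ LinearMap.mulLeft ℂ c) t := by
  induction t with
  | zero => simp
  | add x y hx hy => simp only [map_add, hx, hy]
  | tmul p q => simp

theorem sliceL_leg₁_rmul (f : Module.Dual ℂ A) (c : A) (t : A ⊗[ℂ] A) :
    sliceL f ((Multiplier.leg₁ c).rmul t) = sliceL (f ∘ₗ LinearMap.mulRight ℂ c) t := by
  induction t with
  | zero => simp
  | add x y hx hy => simp only [map_add, hx, hy]
  | tmul p q => simp

theorem sliceL_leg₁_lmul (f : Module.Dual ℂ A) (c : A) (t : A ⊗[ℂ] A) :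
    sliceL f ((Multiplier.leg₁ c).lmul t) = sliceL (f ∘ₗ LinearMap.mulLeft ℂ c) t := by
  induction t with
  | zero => simp
  | add x y hx hy => simp only [map_add, hx, hy]
  | tmul p q => simp

end SliceMul

namespace PreComul

open Multiplier

variable {A : Type*} [NonUnitalRing A] [Module ℂ A] [IsScalarTower ℂ A A] [SMulCommClass ℂ A A]
  (P : PreComul A)

/-- This and the next four are associativity in `M(A ⊗ A)`, with commuting legs: one product of a
coproduct with covers on two sides, bracketed in two ways. -/
theorem leg₁_lmul_comulR₂ (a b c : A) :
    (leg₁ c).lmul (P.comulR₂ a b) = (leg₂ b).rmul (P.comulL₁ a c) := by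
  have := P.nondeg
  apply ofElem_injective
  rw [← mul_ofElem, ← ofElem_mul, P.ofElem_comulR₂, P.ofElem_comulL₁, mul_assoc]

theorem leg₂_lmul_comulR₁ (a b c : A) :
    (leg₂ c).lmul (P.comulR₁ a b) = (leg₁ b).rmul (P.comulL₂ a c) := by
  have := P.nondeg
  apply ofElem_injective
  rw [← mul_ofElem, ← ofElem_mul, P.ofElem_comulR₁, P.ofElem_comulL₂, mul_assoc]

theorem leg₂_lmul_comulR₂ (a b c : A) :
    (leg₂ c).lmul (P.comulR₂ a b) = (leg₂ b).rmul (P.comulL₂ a c) := by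
  have := P.nondeg
  apply ofElem_injective
  rw [← mul_ofElem, ← ofElem_mul, P.ofElem_comulR₂, P.ofElem_comulL₂, mul_assoc]

theorem leg₁_rmul_comulR₂ (a b c : A) :
    (leg₁ c).rmul (P.comulR₂ a b) = (leg₂ b).rmul (P.comulR₁ a c) := by
  have := P.nondeg
  apply ofElem_injective
  rw [← ofElem_mul, ← ofElem_mul, P.ofElem_comulR₂, P.ofElem_comulR₁, mul_assoc, mul_assoc,
    leg₁_mul_leg₂]

theorem leg₁_lmul_comulL₂ (a b c : A) :
    (leg₁ c).lmul (P.comulL₂ a b) = (leg₂ b).lmul (P.comulL₁ a c) := by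
  have := P.nondeg
  apply ofElem_injective
  rw [← mul_ofElem, ← mul_ofElem, P.ofElem_comulL₂, P.ofElem_comulL₁, ← mul_assoc, ← mul_assoc,
    leg₁_mul_leg₂]

theorem lmul_mulSliceR (f : Module.Dual ℂ A) (a b : A) :
    (P.mulSliceR f a).lmul b = sliceR f (P.comulR₁ a b) := rfl

theorem rmul_mulSliceR (f : Module.Dual ℂ A) (a b : A) :
    (P.mulSliceR f a).rmul b = sliceR f (P.comulL₁ a b) := rfl

theorem lmul_mulSliceL (f : Module.Dual ℂ A) (a b : A) :
    (P.mulSliceL f a).lmul b = sliceL f (P.comulR₂ a b) := rfl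

theorem rmul_mulSliceL (f : Module.Dual ℂ A) (a b : A) :
    (P.mulSliceL f a).rmul b = sliceL f (P.comulL₂ a b) := rfl

/-- A cover in the sliced leg can be absorbed into the functional once the remaining leg is covered.
The next six are the variants by leg and side. -/
theorem mul_sliceR_comulR₂ (g : Module.Dual ℂ A) (c a b : A) :
    c * sliceR g (P.comulR₂ a b) = sliceR (g ∘ₗ LinearMap.mulRight ℂ b) (P.comulL₁ a c) := by
  rw [← sliceR_leg₁_lmul, leg₁_lmul_comulR₂, sliceR_leg₂_rmul]

theorem sliceR_comulR₂_mul (g : Module.Dual ℂ A) (c a b : A) :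
    sliceR g (P.comulR₂ a b) * c = sliceR (g ∘ₗ LinearMap.mulRight ℂ b) (P.comulR₁ a c) := by
  rw [← sliceR_leg₁_rmul, leg₁_rmul_comulR₂, sliceR_leg₂_rmul]

theorem sliceR_comulL₂_mul (g : Module.Dual ℂ A) (c a b : A) :
    sliceR g (P.comulL₂ a b) * c = sliceR (g ∘ₗ LinearMap.mulLeft ℂ b) (P.comulR₁ a c) := by
  rw [← sliceR_leg₁_rmul, ← leg₂_lmul_comulR₁, sliceR_leg₂_lmul]

theorem mul_sliceL_comulR₁ (g : Module.Dual ℂ A) (c a b : A) :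
    c * sliceL g (P.comulR₁ a b) = sliceL (g ∘ₗ LinearMap.mulRight ℂ b) (P.comulL₂ a c) := by
  rw [← sliceL_leg₂_lmul, leg₂_lmul_comulR₁, sliceL_leg₁_rmul]

theorem sliceL_comulR₁_mul (g : Module.Dual ℂ A) (c a b : A) :
    sliceL g (P.comulR₁ a b) * c = sliceL (g ∘ₗ LinearMap.mulRight ℂ b) (P.comulR₂ a c) := by
  rw [← sliceL_leg₂_rmul, ← leg₁_rmul_comulR₂, sliceL_leg₁_rmul]

theorem mul_sliceL_comulL₁ (g : Module.Dual ℂ A) (c a b : A) :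
    c * sliceL g (P.comulL₁ a b) = sliceL (g ∘ₗ LinearMap.mulLeft ℂ b) (P.comulL₂ a c) := by
  rw [← sliceL_leg₂_lmul, ← leg₁_lmul_comulL₂, sliceL_leg₁_lmul]

theorem sliceL_comulL₁_mul (g : Module.Dual ℂ A) (c a b : A) :
    sliceL g (P.comulL₁ a b) * c = sliceL (g ∘ₗ LinearMap.mulLeft ℂ b) (P.comulR₂ a c) := by
  rw [← sliceL_leg₂_rmul, ← leg₁_lmul_comulR₂, sliceL_leg₁_lmul]

end PreComul

theorem Submodule.eq_top_of_forall_dual {V : Type*} [AddCommGroup V] [Module ℂ V]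
    (W : Submodule ℂ V) (h : ∀ f : Module.Dual ℂ V, (∀ x ∈ W, f x = 0) → f = 0) : W = ⊤ := by
  by_contra hW
  obtain ⟨f, hf, hle⟩ := Submodule.exists_le_ker_of_lt_top W (lt_top_iff_ne_top.2 hW)
  exact hf (h f fun x hx => hle hx)

theorem sliceR_smul_left {A : Type*} [AddCommGroup A] [Module ℂ A] (r : ℂ) (f : Module.Dual ℂ A)
    (t : A ⊗[ℂ] A) : sliceR (r • f) t = r • sliceR f t := by
  induction t with
  | zero => simp
  | add x y hx hy => simp [hx, hy]
  | tmul p q => simp [mul_smul]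

theorem sliceL_smul_left {A : Type*} [AddCommGroup A] [Module ℂ A] (r : ℂ) (f : Module.Dual ℂ A)
    (t : A ⊗[ℂ] A) : sliceL (r • f) t = r • sliceL f t := by
  induction t with
  | zero => simp
  | add x y hx hy => simp [hx, hy]
  | tmul p q => simp [mul_smul]

/-! ### Counit and density of slices. -/

namespace QuantumHypergroup

open Multiplier

variable {A : Type*} [NonUnitalRing A] [Module ℂ A] [IsScalarTower ℂ A A] [SMulCommClass ℂ A A]
  (H : QuantumHypergroup A)

/-- The counit as a linear functional. -/
abbrev counit : Module.Dual ℂ A := (H.ε : A →ₗ[ℂ] ℂ)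

theorem counit_mul (a b : A) : H.counit (a * b) = H.counit a * H.counit b := map_mul H.ε a b

theorem sliceL_counit_comulR₂ (a b : A) : sliceL H.counit (H.comulR₂ a b) = a * b :=
  congrArg (fun m : Multiplier A => m.lmul b) (H.counit_left a)

theorem sliceL_counit_comulL₂ (a b : A) : sliceL H.counit (H.comulL₂ a b) = b * a :=
  congrArg (fun m : Multiplier A => m.rmul b) (H.counit_left a)

theorem sliceR_counit_comulR₁ (a b : A) : sliceR H.counit (H.comulR₁ a b) = a * b :=
  congrArg (fun m : Multiplier A => m.lmul b) (H.counit_right a)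

theorem counit_comp_mulRight (b : A) :
    H.counit ∘ₗ LinearMap.mulRight ℂ b = H.counit b • H.counit := by
  ext x
  simp [mul_comm]

theorem counit_comp_mulLeft (b : A) :
    H.counit ∘ₗ LinearMap.mulLeft ℂ b = H.counit b • H.counit := by
  ext x
  simp

/-- Since `ε` is a character, the cover `b` sitting in the sliced leg comes out as the scalar
`ε(b)`. -/
theorem sliceR_counit_comulR₂ (a b : A) :
    sliceR H.counit (H.comulR₂ a b) = H.counit b • a := by
  have := H.nondeg
  rw [← sub_eq_zero]
  refine NondegMul.left _ fun c => ?_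
  rw [sub_mul, H.sliceR_comulR₂_mul, counit_comp_mulRight, sliceR_smul_left,
    sliceR_counit_comulR₁, smul_mul_assoc, sub_self]

theorem sliceR_counit_comulL₂ (a b : A) :
    sliceR H.counit (H.comulL₂ a b) = H.counit b • a := by
  have := H.nondeg
  rw [← sub_eq_zero]
  refine NondegMul.left _ fun c => ?_
  rw [sub_mul, H.sliceR_comulL₂_mul, counit_comp_mulLeft, sliceR_smul_left,
    sliceR_counit_comulR₁, smul_mul_assoc, sub_self]

theorem sliceL_counit_comulR₁ (a b : A) :
    sliceL H.counit (H.comulR₁ a b) = H.counit b • a := by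
  have := H.nondeg
  rw [← sub_eq_zero]
  refine NondegMul.left _ fun c => ?_
  rw [sub_mul, H.sliceL_comulR₁_mul, counit_comp_mulRight, sliceL_smul_left,
    sliceL_counit_comulR₂, smul_mul_assoc, sub_self]

theorem sliceL_counit_comulL₁ (a b : A) :
    sliceL H.counit (H.comulL₁ a b) = H.counit b • a := by
  have := H.nondeg
  rw [← sub_eq_zero]
  refine NondegMul.left _ fun c => ?_
  rw [sub_mul, H.sliceL_comulL₁_mul, counit_comp_mulLeft, sliceL_smul_left,
    sliceL_counit_comulR₂, smul_mul_assoc, sub_self]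

/-- If `ε` vanished, `a b = (ε ⊗ ι)(Δ(a)(1 ⊗ b))` would make all products zero, hence `A = 0` and `φ
= 0`. -/
theorem exists_counit_eq_one : ∃ e, H.counit e = 1 := by
  by_contra! h
  have h0 : H.counit = 0 := by
    ext b
    by_contra hb
    exact h ((H.counit b)⁻¹ • b) (by rw [map_smul, smul_eq_mul, inv_mul_cancel₀ hb])
  have := H.nondeg
  refine H.φ_ne_zero (LinearMap.ext fun a => ?_)
  have ha : a = 0 := by
    refine NondegMul.left _ fun b => ?_
    rw [← H.sliceL_counit_comulR₂, h0]
    simp [sliceL]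
  rw [ha, map_zero, map_zero]

theorem exists_φ_eq_one : ∃ e, H.φ e = 1 := by
  by_contra! h
  refine H.φ_ne_zero (LinearMap.ext fun b => ?_)
  by_contra hb
  exact h ((H.φ b)⁻¹ • b) (by rw [map_smul, smul_eq_mul, inv_mul_cancel₀ hb])

section Density

variable {g : Module.Dual ℂ A} {W : Submodule ℂ A}

/-- By duality it suffices that a functional `f` killing all slices is zero. Then `g` kills `(f ⊗
ι)(Δ(a)(1 ⊗ e))` times anything, so this element vanishes by faithfulness, and `ε` sends it to
`f(a)` when `ε(e) = 1`. -/
theorem eq_top_of_sliceR_comulR₂ (hg : ∀ a, (∀ b, g (a * b) = 0) → a = 0)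
    (hW : ∀ a b, sliceR g (H.comulR₂ a b) ∈ W) : W = ⊤ := by
  obtain ⟨e, he⟩ := H.exists_counit_eq_one
  refine W.eq_top_of_forall_dual fun f hf => LinearMap.ext fun a => ?_
  have h1 : sliceL f (H.comulR₂ a e) = 0 := by
    refine hg _ fun c => ?_
    rw [← H.lmul_mulSliceL, ← lmul_mul, H.lmul_mulSliceL, ← sliceR_sliceL_comm]
    exact hf _ (hW _ _)
  have h2 := sliceR_sliceL_comm f H.counit (H.comulR₂ a e)
  rw [h1, sliceR_counit_comulR₂, he, one_smul, map_zero] at h2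
  simpa using h2

theorem eq_top_of_sliceR_comulL₂ (hg : ∀ a, (∀ b, g (b * a) = 0) → a = 0)
    (hW : ∀ a b, sliceR g (H.comulL₂ a b) ∈ W) : W = ⊤ := by
  obtain ⟨e, he⟩ := H.exists_counit_eq_one
  refine W.eq_top_of_forall_dual fun f hf => LinearMap.ext fun a => ?_
  have h1 : sliceL f (H.comulL₂ a e) = 0 := by
    refine hg _ fun c => ?_
    rw [← H.rmul_mulSliceL, ← rmul_mul, H.rmul_mulSliceL, ← sliceR_sliceL_comm]
    exact hf _ (hW _ _)
  have h2 := sliceR_sliceL_comm f H.counit (H.comulL₂ a e)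
  rw [h1, sliceR_counit_comulL₂, he, one_smul, map_zero] at h2
  simpa using h2

theorem eq_top_of_sliceL_comulR₁ (hg : ∀ a, (∀ b, g (a * b) = 0) → a = 0)
    (hW : ∀ a b, sliceL g (H.comulR₁ a b) ∈ W) : W = ⊤ := by
  obtain ⟨e, he⟩ := H.exists_counit_eq_one
  refine W.eq_top_of_forall_dual fun f hf => LinearMap.ext fun a => ?_
  have h1 : sliceR f (H.comulR₁ a e) = 0 := by
    refine hg _ fun c => ?_
    rw [← H.lmul_mulSliceR, ← lmul_mul, H.lmul_mulSliceR, sliceR_sliceL_comm]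
    exact hf _ (hW _ _)
  have h2 := sliceR_sliceL_comm H.counit f (H.comulR₁ a e)
  rw [h1, sliceL_counit_comulR₁, he, one_smul, map_zero] at h2
  simpa using h2.symm

theorem eq_top_of_sliceL_comulL₁ (hg : ∀ a, (∀ b, g (b * a) = 0) → a = 0)
    (hW : ∀ a b, sliceL g (H.comulL₁ a b) ∈ W) : W = ⊤ := by
  obtain ⟨e, he⟩ := H.exists_counit_eq_one
  refine W.eq_top_of_forall_dual fun f hf => LinearMap.ext fun a => ?_
  have h1 : sliceR f (H.comulL₁ a e) = 0 := by
    refine hg _ fun c => ?_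
    rw [← H.rmul_mulSliceR, ← rmul_mul, H.rmul_mulSliceR, sliceR_sliceL_comm]
    exact hf _ (hW _ _)
  have h2 := sliceR_sliceL_comm H.counit f (H.comulL₁ a e)
  rw [h1, sliceL_counit_comulL₁, he, one_smul, map_zero] at h2
  simpa using h2.symm

end Density

theorem hom_ext_of_sliceR_φ {V : Type*} [AddCommGroup V] [Module ℂ V] {F G : A →ₗ[ℂ] V}
    (h : ∀ a b, F (sliceR H.φ (H.comulR₂ a b)) = G (sliceR H.φ (H.comulR₂ a b))) : F = G :=
  LinearMap.eqLocus_eq_top.1 (H.eq_top_of_sliceR_comulR₂ H.φ_faithful_left h)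

/-! ### Sliced coassociativity. -/

section Coassociativity

variable (f g : Module.Dual ℂ A)

/-- Coassociativity with its third leg sliced, which makes it an identity in `A ⊗ A`. -/
theorem comulL₁_sliceR_comulR₂ (x d e : A) : H.comulL₁ (sliceR g (H.comulR₂ x e)) d =
    (sliceR g ∘ₗ H.comulR₂.flip e).lTensor A (H.comulL₁ x d) := by
  have h := congrArg ((sliceR g).lTensor A) (H.coassoc d x e)
  rw [← LinearMap.comp_apply (f := (sliceR g).lTensor A), ← LinearMap.lTensor_comp] at h
  rw [← h]
  have h1 : ∀ (s : A ⊗[ℂ] A) (q : A),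
      (sliceR g).lTensor A (TensorProduct.assoc ℂ A A A (s ⊗ₜ[ℂ] q)) = g q • s := by
    intro s q
    induction s with
    | zero => simp
    | add y z hy hz => simp only [TensorProduct.add_tmul, map_add, hy, hz, smul_add]
    | tmul p r => simp
  generalize H.comulR₂ x e = t
  induction t with
  | zero => simp
  | add y z hy hz => simp only [map_add, LinearMap.add_apply, hy, hz]
  | tmul p q => rw [LinearMap.rTensor_tmul, h1]; simp

theorem comulR₂_sliceL_comulL₁ (x d e : A) : H.comulR₂ (sliceL f (H.comulL₁ x d)) e =
    (sliceL f ∘ₗ H.comulL₁.flip d).rTensor A (H.comulR₂ x e) := by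
  have h := congrArg ((sliceL f).rTensor A ∘ₗ (TensorProduct.assoc ℂ A A A).symm.toLinearMap)
    (H.coassoc d x e)
  simp only [LinearMap.comp_apply, LinearEquiv.coe_coe, LinearEquiv.symm_apply_apply] at h
  rw [LinearMap.rTensor_comp, LinearMap.comp_apply, h]
  have h1 : ∀ (s : A ⊗[ℂ] A) (q : A),
      (sliceL f).rTensor A ((TensorProduct.assoc ℂ A A A).symm (q ⊗ₜ[ℂ] s)) = f q • s := by
    intro s q
    induction s with
    | zero => simp
    | add y z hy hz => simp only [TensorProduct.tmul_add, map_add, hy, hz, smul_add]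
    | tmul p r => simp [TensorProduct.smul_tmul']
  generalize H.comulL₁ x d = t
  induction t with
  | zero => simp
  | add y z hy hz => simp only [map_add, LinearMap.add_apply, hy, hz]
  | tmul p q => rw [LinearMap.lTensor_tmul, h1]; simp

theorem leg₂_lmul_rTensor (F : A →ₗ[ℂ] A) (c : A) (t : A ⊗[ℂ] A) :
    (leg₂ c).lmul (F.rTensor A t) = F.rTensor A ((leg₂ c).lmul t) := by
  induction t with
  | zero => simp
  | add y z hy hz => simp only [map_add, hy, hz]
  | tmul p q => simp

theorem leg₂_rmul_rTensor (F : A →ₗ[ℂ] A) (c : A) (t : A ⊗[ℂ] A) :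
    (leg₂ c).rmul (F.rTensor A t) = F.rTensor A ((leg₂ c).rmul t) := by
  induction t with
  | zero => simp
  | add y z hy hz => simp only [map_add, hy, hz]
  | tmul p q => simp

/-- The cover `e` moves from the right to the left of the last leg, after an auxiliary right cover
that is cancelled. -/
theorem comulL₂_sliceL_comulL₁ (x d e : A) : H.comulL₂ (sliceL f (H.comulL₁ x d)) e =
    (sliceL f ∘ₗ H.comulL₁.flip d).rTensor A (H.comulL₂ x e) := by
  have := H.nondeg
  refine eq_of_leg₂_rmul fun c => ?_
  rw [← H.leg₂_lmul_comulR₂, comulR₂_sliceL_comulL₁, leg₂_lmul_rTensor, leg₂_rmul_rTensor,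
    H.leg₂_lmul_comulR₂]

/-- Tested against functionals on the first leg, this is `comulL₂_sliceL_comulL₁`, because slices of
different legs commute. -/
theorem comulL₁_sliceR_comulL₂ (x d e : A) : H.comulL₁ (sliceR g (H.comulL₂ x e)) d =
    (sliceR g ∘ₗ H.comulL₂.flip e).lTensor A (H.comulL₁ x d) := by
  rw [← sub_eq_zero]
  refine eq_zero_of_sliceL _ fun f => ?_
  rw [map_sub, sub_eq_zero, sliceL_lTensor]
  have h := sliceR_rTensor g (sliceL f ∘ₗ H.comulL₁.flip d) (H.comulL₂ x e)
  rw [← comulL₂_sliceL_comulL₁] at h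
  simpa using h.symm

end Coassociativity

/-! ### The antipode flips the comultiplication; the right integral. -/

/-- The anti-automorphism of `A ⊗ A` given by the flip and `S ⊗ S`. -/
def flipS : A ⊗[ℂ] A ≃ₗ[ℂ] A ⊗[ℂ] A := TensorProduct.congr H.S H.S ≪≫ₗ TensorProduct.comm ℂ A A

@[simp] theorem flipS_tmul (p q : A) : H.flipS (p ⊗ₜ[ℂ] q) = H.S q ⊗ₜ[ℂ] H.S p := by
  simp [flipS]

@[simp] theorem flipS_symm_tmul (p q : A) :
    H.flipS.symm (p ⊗ₜ[ℂ] q) = H.S.symm q ⊗ₜ[ℂ] H.S.symm p := by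
  simp [LinearEquiv.symm_apply_eq]

theorem flipS_mul (s t : A ⊗[ℂ] A) : H.flipS (s * t) = H.flipS t * H.flipS s := by
  induction s with
  | zero => simp
  | add x y hx hy => simp only [add_mul, mul_add, map_add, hx, hy]
  | tmul p q =>
    induction t with
    | zero => simp
    | add x y hx hy => simp only [add_mul, mul_add, map_add, hx, hy]
    | tmul p' q' => simp [H.S_mul]

theorem sliceR_flipS (f : Module.Dual ℂ A) (t : A ⊗[ℂ] A) :
    sliceR f (H.flipS t) = H.S (sliceL (f ∘ₗ H.S.toLinearMap) t) := by
  induction t with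
  | zero => simp
  | add x y hx hy => simp only [map_add, hx, hy]
  | tmul p q => simp

theorem sliceL_flipS (f : Module.Dual ℂ A) (t : A ⊗[ℂ] A) :
    sliceL f (H.flipS t) = H.S (sliceR (f ∘ₗ H.S.toLinearMap) t) := by
  induction t with
  | zero => simp
  | add x y hx hy => simp only [map_add, hx, hy]
  | tmul p q => simp

theorem S_symm_mul (a b : A) : H.S.symm (a * b) = H.S.symm b * H.S.symm a :=
  H.S.injective (by simp [H.S_mul])

theorem antiMap_leg₁ (c : A) : antiMap H.flipS H.flipS_mul (leg₁ c) = leg₂ (H.S c) := by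
  refine ext' (fun t => ?_) (fun t => ?_) <;> induction t with
  | zero => simp
  | add x y hx hy => simp only [map_add, hx, hy]
  | tmul p q => simp [lmul_antiMap, rmul_antiMap, H.S_mul]

theorem antiMap_leg₂ (c : A) : antiMap H.flipS H.flipS_mul (leg₂ c) = leg₁ (H.S c) := by
  refine ext' (fun t => ?_) (fun t => ?_) <;> induction t with
  | zero => simp
  | add x y hx hy => simp only [map_add, hx, hy]
  | tmul p q => simp [lmul_antiMap, rmul_antiMap, H.S_mul]

/-- The identity `Δ ∘ S = flip (S ⊗ S) Δ`, in covered form. By density `p` may be a slice, on which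
`S` is given by `S_slice`; coassociativity then expresses both sides through `(d ⊗ 1)Δ(b)`. -/
theorem comulR₂_S (p c : A) : H.comulR₂ (H.S p) (H.S c) = H.flipS (H.comulL₁ p c) := by
  have := H.nondeg
  suffices h : H.comulR₂.flip (H.S c) ∘ₗ H.S.toLinearMap = H.flipS.toLinearMap ∘ₗ H.comulL₁.flip c
    from LinearMap.congr_fun h p
  refine H.hom_ext_of_sliceR_φ fun a b => ?_
  simp only [LinearMap.comp_apply, LinearMap.flip_apply, LinearEquiv.coe_coe]
  refine eq_of_leg₁_lmul fun d => ?_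
  rw [H.S_slice, H.leg₁_lmul_comulR₂, comulL₁_sliceR_comulL₂, comulL₁_sliceR_comulR₂]
  -- The map `k s v = (ι ⊗ φ)((1 ⊗ v) s)` isolates the dependence on `s = (d ⊗ 1)Δ(b)`, so that the
  -- comparison can be made on elementary tensors.
  let k : A ⊗[ℂ] A →ₗ[ℂ] A →ₗ[ℂ] A :=
    (LinearMap.lTensorHom A ∘ₗ LinearMap.mul ℂ A).flip.compr₂ (sliceR H.φ)
  have hk : ∀ s v, k s v = sliceR H.φ ((leg₂ v).lmul s) := fun s v => rfl
  have h1 : ∀ t, (leg₁ d).lmul (H.flipS ((sliceR H.φ ∘ₗ H.comulR₂.flip b).lTensor A t)) =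
      TensorProduct.comm ℂ A A (TensorProduct.map H.S.toLinearMap (k (H.comulL₁ b d)) t) := by
    intro t
    induction t with
    | zero => simp
    | add x y hx hy => simp only [map_add, hx, hy]
    | tmul u v =>
      simp [hk, H.S_slice, ← H.leg₁_lmul_comulL₂, sliceR_leg₁_lmul]
  have h2 : ∀ (p q : A) (t : A ⊗[ℂ] A),
      TensorProduct.comm ℂ A A (TensorProduct.map H.S.toLinearMap (k (p ⊗ₜ[ℂ] q)) t) =
      p ⊗ₜ[ℂ] H.S (sliceR H.φ ((leg₂ q).rmul t)) := by
    intro p q t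
    induction t with
    | zero => simp
    | add x y hx hy => simp only [map_add, hx, hy, TensorProduct.tmul_add]
    | tmul u v => simp [hk]
  rw [h1]
  generalize H.comulL₁ b d = s
  induction s with
  | zero => simp
  | add x y hx hy =>
    simp only [map_add, hx, hy, TensorProduct.map_add_right, LinearMap.add_apply]
  | tmul p q =>
    -- For `s = p ⊗ q` the second leg is `S(c · (ι ⊗ φ)(Δ(a)(1 ⊗ q)))`, and one more use of
    -- `S_slice` gives the other side.
    rw [h2, ← H.leg₁_lmul_comulR₂, sliceR_leg₁_lmul, H.S_mul, H.S_slice]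
    simp

theorem comul_S (a : A) : H.comul (H.S a) = antiMap H.flipS H.flipS_mul (H.comul a) := by
  have := H.nondeg
  refine ext_mul_leg₂ fun c => ?_
  obtain ⟨c, rfl⟩ := H.S.surjective c
  rw [← H.ofElem_comulR₂, ← antiMap_leg₁, ← antiMap_mul, ← H.ofElem_comulL₁, antiMap_ofElem,
    comulR₂_S]

theorem comulL₁_S (p c : A) : H.comulL₁ (H.S p) (H.S c) = H.flipS (H.comulR₂ p c) := by
  have := H.nondeg
  apply ofElem_injective
  rw [← antiMap_ofElem H.flipS H.flipS_mul, H.ofElem_comulL₁, H.ofElem_comulR₂, antiMap_mul,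
    antiMap_leg₂, comul_S]

theorem comulL₂_S (p c : A) : H.comulL₂ (H.S p) (H.S c) = H.flipS (H.comulR₁ p c) := by
  have := H.nondeg
  apply ofElem_injective
  rw [← antiMap_ofElem H.flipS H.flipS_mul, H.ofElem_comulL₂, H.ofElem_comulR₁, antiMap_mul,
    antiMap_leg₁, comul_S]

theorem counit_S (a : A) : H.counit (H.S a) = H.counit a := by
  suffices h : H.counit ∘ₗ H.S.toLinearMap = H.counit from LinearMap.congr_fun h a
  refine H.hom_ext_of_sliceR_φ fun a b => ?_
  simp only [LinearMap.comp_apply, LinearEquiv.coe_coe]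
  rw [H.S_slice, sliceR_sliceL_comm, sliceR_sliceL_comm, sliceL_counit_comulL₂,
    sliceL_counit_comulR₂]

theorem ψ_apply (a : A) : H.ψ a = H.φ (H.S a) := rfl

theorem ψ_faithful_right (a : A) (h : ∀ b, H.ψ (b * a) = 0) : a = 0 := by
  apply H.S.injective
  rw [map_zero]
  refine H.φ_faithful_left _ fun b => ?_
  rw [← H.S.apply_symm_apply b, ← H.S_mul]
  exact h _

theorem sliceR_φ_comulR₁ (a b : A) : sliceR H.φ (H.comulR₁ a b) = H.φ a • b :=
  congrArg (fun m : Multiplier A => m.lmul b) (H.φ_left_invariant a)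

theorem sliceR_φ_comulL₁ (a b : A) : sliceR H.φ (H.comulL₁ a b) = H.φ a • b :=
  congrArg (fun m : Multiplier A => m.rmul b) (H.φ_left_invariant a)

/-- Right invariance of `ψ` is left invariance of `φ` carried through the flip by `S`. -/
theorem sliceL_ψ_comulR₂ (a b : A) : sliceL H.ψ (H.comulR₂ a b) = H.ψ a • b := by
  apply H.S.injective
  rw [ψ, ← sliceR_flipS, ← comulL₁_S, sliceR_φ_comulL₁, map_smul]
  rfl

/-- `S((ψ ⊗ ι)((b ⊗ 1)Δ(a))) = (ψ ⊗ ι)(Δ(b)(a ⊗ 1))` -/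
theorem S_sliceL_ψ_comulL₁ (a b : A) :
    H.S (sliceL H.ψ (H.comulL₁ a b)) = sliceL H.ψ (H.comulR₁ b a) := by
  apply H.S.injective
  rw [ψ, ← sliceR_flipS, ← comulR₂_S, H.S_slice, comulL₂_S, sliceR_flipS]

end QuantumHypergroup

/-! ### Modular automorphisms and the modular element. -/

namespace PreComul

open Multiplier

variable {A : Type*} [NonUnitalRing A] [Module ℂ A] [IsScalarTower ℂ A A] [SMulCommClass ℂ A A]
  (P : PreComul A) (f g : Module.Dual ℂ A) (b c x : A)

/-- Both sides are `g ⊗ f` applied to `(1 ⊗ x)Δ(c)(b ⊗ 1)`, with the legs sliced in either order.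
The next three use other placements of the covers. -/
theorem apply_mul_sliceL_comulR₁ :
    f (x * sliceL g (P.comulR₁ c b)) = g (sliceR f (P.comulL₂ c x) * b) := by
  rw [← sliceL_leg₂_lmul, leg₂_lmul_comulR₁, ← sliceR_sliceL_comm, sliceR_leg₁_rmul]

theorem apply_mul_sliceR_comulR₂ :
    g (b * sliceR f (P.comulR₂ c x)) = f (sliceL g (P.comulL₁ c b) * x) := by
  rw [← sliceL_leg₂_rmul, ← leg₁_lmul_comulR₂, ← sliceR_sliceL_comm, sliceR_leg₁_lmul]

theorem apply_sliceR_comulR₂_mul :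
    g (sliceR f (P.comulR₂ c x) * b) = f (sliceL g (P.comulR₁ c b) * x) := by
  rw [← sliceL_leg₂_rmul, ← leg₁_rmul_comulR₂, ← sliceR_sliceL_comm, sliceR_leg₁_rmul]

theorem apply_mul_sliceR_comulL₂ :
    g (b * sliceR f (P.comulL₂ c x)) = f (x * sliceL g (P.comulL₁ c b)) := by
  rw [← sliceL_leg₂_lmul, ← leg₁_lmul_comulL₂, ← sliceR_sliceL_comm, sliceR_leg₁_lmul]

end PreComul

namespace QuantumHypergroup

open Multiplier

variable {A : Type*} [NonUnitalRing A] [Module ℂ A] [IsScalarTower ℂ A A] [SMulCommClass ℂ A A]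
  (H : QuantumHypergroup A)

/-- The antipode formula of `φ` moves the coproduct from `c` to `x`, and that of `ψ` moves it from
`x` to `b`. What is left is a functional of `x` of the form `ψ(b' x)`. -/
theorem φ_mul_sliceL_comulR₁ (x b c : A) : H.φ (x * sliceL H.φ (H.comulR₁ c (H.S b))) =
    H.ψ (sliceR (H.φ ∘ₗ H.S.symm.toLinearMap) (H.comulL₂ b (H.S c)) * x) := by
  rw [H.apply_mul_sliceL_comulR₁, ← H.S_slice, ← H.S_mul, ← ψ_apply, H.apply_mul_sliceR_comulR₂,
    ← H.apply_mul_sliceL_comulR₁, ← S_sliceL_ψ_comulL₁]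
  simp [S_symm_mul]

theorem φ_mul_sliceL_comulL₁ (x b c : A) : H.φ (x * sliceL H.φ (H.comulL₁ c (H.S b))) =
    H.ψ (x * sliceR H.ψ (H.comulL₂ b (H.S.symm c))) := by
  rw [← H.apply_mul_sliceR_comulL₂, ← H.S_slice, ← H.S_mul, ← ψ_apply, H.apply_sliceR_comulR₂_mul,
    H.apply_mul_sliceR_comulL₂, ← S_sliceL_ψ_comulL₁, H.ψ_apply (_ * _), H.S_mul,
    LinearEquiv.apply_symm_apply]

/-- The set of good `c` is a subspace containing a dense family of slices, by
`φ_mul_sliceL_comulR₁`. The converse below reads the same identity from its right side, whose slices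
are dense as well. -/
theorem exists_φ_mul_eq_ψ_mul_left (c : A) : ∃ b, ∀ x, H.φ (x * c) = H.ψ (b * x) := by
  let W : Submodule ℂ A :=
    { carrier := {c | ∃ b, ∀ x, H.φ (x * c) = H.ψ (b * x)}
      zero_mem' := ⟨0, fun x => by simp⟩
      add_mem' := by
        rintro c c' ⟨b, hb⟩ ⟨b', hb'⟩
        exact ⟨b + b', fun x => by simp [mul_add, add_mul, hb, hb']⟩
      smul_mem' := by
        rintro r c ⟨b, hb⟩
        exact ⟨r • b, fun x => by simp [mul_smul_comm, smul_mul_assoc, hb]⟩ }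
  have hW : W = ⊤ := H.eq_top_of_sliceL_comulR₁ H.φ_faithful_left fun a b => by
    obtain ⟨b, rfl⟩ := H.S.surjective b
    exact ⟨_, fun x => H.φ_mul_sliceL_comulR₁ x b a⟩
  exact (hW ▸ Submodule.mem_top : c ∈ W)

theorem exists_ψ_mul_left_eq_φ_mul (b : A) : ∃ c, ∀ x, H.φ (x * c) = H.ψ (b * x) := by
  let W : Submodule ℂ A :=
    { carrier := {b | ∃ c, ∀ x, H.φ (x * c) = H.ψ (b * x)}
      zero_mem' := ⟨0, fun x => by simp⟩
      add_mem' := by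
        rintro c c' ⟨b, hb⟩ ⟨b', hb'⟩
        exact ⟨b + b', fun x => by simp [mul_add, add_mul, hb, hb']⟩
      smul_mem' := by
        rintro r c ⟨b, hb⟩
        exact ⟨r • b, fun x => by simp [mul_smul_comm, smul_mul_assoc, hb]⟩ }
  have hφ : ∀ a, (∀ b, (H.φ ∘ₗ H.S.symm.toLinearMap) (b * a) = 0) → a = 0 := by
    intro a ha
    apply H.S.symm.injective
    rw [map_zero]
    refine H.φ_faithful_left _ fun b => ?_
    simpa [S_symm_mul] using ha (H.S b)
  have hW : W = ⊤ := H.eq_top_of_sliceR_comulL₂ hφ fun a b => by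
    obtain ⟨b, rfl⟩ := H.S.surjective b
    exact ⟨_, fun x => H.φ_mul_sliceL_comulR₁ x a b⟩
  exact (hW ▸ Submodule.mem_top : b ∈ W)

theorem exists_φ_mul_eq_ψ_mul_right (c : A) : ∃ b, ∀ x, H.φ (x * c) = H.ψ (x * b) := by
  let W : Submodule ℂ A :=
    { carrier := {c | ∃ b, ∀ x, H.φ (x * c) = H.ψ (x * b)}
      zero_mem' := ⟨0, fun x => by simp⟩
      add_mem' := by
        rintro c c' ⟨b, hb⟩ ⟨b', hb'⟩
        exact ⟨b + b', fun x => by simp [mul_add, hb, hb']⟩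
      smul_mem' := by
        rintro r c ⟨b, hb⟩
        exact ⟨r • b, fun x => by simp [mul_smul_comm, hb]⟩ }
  have hW : W = ⊤ := H.eq_top_of_sliceL_comulL₁ H.φ_faithful_right fun a b => by
    obtain ⟨b, rfl⟩ := H.S.surjective b
    exact ⟨_, fun x => H.φ_mul_sliceL_comulL₁ x b a⟩
  exact (hW ▸ Submodule.mem_top : c ∈ W)

theorem exists_ψ_mul_right_eq_φ_mul (b : A) : ∃ c, ∀ x, H.φ (x * c) = H.ψ (x * b) := by
  let W : Submodule ℂ A :=
    { carrier := {b | ∃ c, ∀ x, H.φ (x * c) = H.ψ (x * b)}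
      zero_mem' := ⟨0, fun x => by simp⟩
      add_mem' := by
        rintro c c' ⟨b, hb⟩ ⟨b', hb'⟩
        exact ⟨b + b', fun x => by simp [mul_add, hb, hb']⟩
      smul_mem' := by
        rintro r c ⟨b, hb⟩
        exact ⟨r • b, fun x => by simp [mul_smul_comm, hb]⟩ }
  have hW : W = ⊤ := H.eq_top_of_sliceR_comulL₂ H.ψ_faithful_right fun a b => by
    obtain ⟨c, rfl⟩ := H.S.symm.surjective b
    exact ⟨_, fun x => H.φ_mul_sliceL_comulL₁ x a c⟩
  exact (hW ▸ Submodule.mem_top : b ∈ W)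

theorem ψ_mul_eq (a b : A) : H.ψ (a * b) = H.φ (H.S b * H.S a) := by rw [ψ_apply, H.S_mul]

theorem φ_mul_eq (a b : A) : H.φ (a * b) = H.ψ (H.S.symm b * H.S.symm a) := by
  simp [ψ_mul_eq]

/-- As `S` turns `φ(a ·)` into a functional of type `ψ(· b)`, passing between `φ` and `ψ` on either
side produces the form `φ(· c)`. -/
theorem exists_φ_left_eq_right (a : A) : ∃ c, ∀ x, H.φ (x * c) = H.φ (a * x) := by
  obtain ⟨c, hc⟩ := H.exists_ψ_mul_right_eq_φ_mul (H.S.symm a)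
  obtain ⟨b, hb⟩ := H.exists_φ_mul_eq_ψ_mul_left c
  refine ⟨H.S b, fun x => ?_⟩
  rw [H.φ_mul_eq a, ← hc, hb, ψ_mul_eq, LinearEquiv.apply_symm_apply]

theorem exists_φ_right_eq_left (c : A) : ∃ a, ∀ x, H.φ (x * c) = H.φ (a * x) := by
  obtain ⟨b, hb⟩ := H.exists_ψ_mul_left_eq_φ_mul (H.S.symm c)
  obtain ⟨a, ha⟩ := H.exists_φ_mul_eq_ψ_mul_right b
  refine ⟨H.S a, fun x => ?_⟩
  rw [H.φ_mul_eq x, ← hb, ha, ψ_mul_eq, LinearEquiv.apply_symm_apply]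

/-- The linear map `a ↦ φ(a ·)`. -/
def leftFunctional : A →ₗ[ℂ] Module.Dual ℂ A := (LinearMap.mul ℂ A).compr₂ H.φ

theorem leftFunctional_apply (a x : A) : H.leftFunctional a x = H.φ (a * x) := rfl

theorem leftFunctional_injective : Function.Injective H.leftFunctional := by
  rw [injective_iff_map_eq_zero]
  intro a ha
  exact H.φ_faithful_left a fun b => by rw [← H.leftFunctional_apply, ha]; rfl

theorem range_leftFunctional : LinearMap.range H.leftFunctional = H.dual := by
  refine le_antisymm ?_ ?_
  · rintro _ ⟨a, rfl⟩
    obtain ⟨c, hc⟩ := H.exists_φ_left_eq_right a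
    exact ⟨c, LinearMap.ext hc⟩
  · rintro _ ⟨c, rfl⟩
    obtain ⟨a, ha⟩ := H.exists_φ_right_eq_left c
    exact ⟨a, LinearMap.ext fun x => (ha x).symm⟩

/-- The linear bijection `a ↦ φ(a ·)` of `A` onto `Â`. -/
def leftDual : A ≃ₗ[ℂ] H.dual :=
  (LinearEquiv.ofInjective _ H.leftFunctional_injective).trans
    (LinearEquiv.ofEq _ _ H.range_leftFunctional)

theorem leftDual_apply (a x : A) : (H.leftDual a : Module.Dual ℂ A) x = H.φ (a * x) := rfl

/-- The modular automorphism of `φ`. -/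
def modAut : A ≃ₗ[ℂ] A := H.leftDual.trans H.toDual.symm

theorem φ_mul_modAut (a b : A) : H.φ (a * b) = H.φ (b * H.modAut a) := by
  have h : H.toDual (H.modAut a) = H.leftDual a := by simp [modAut]
  rw [← H.toDual_apply (H.modAut a), h, leftDual_apply]

theorem modAut_mul (a b : A) : H.modAut (a * b) = H.modAut a * H.modAut b := by
  rw [← sub_eq_zero]
  refine H.φ_faithful_right _ fun c => ?_
  rw [mul_sub, map_sub, ← φ_mul_modAut, ← mul_assoc, ← φ_mul_modAut, ← mul_assoc,
    ← φ_mul_modAut, mul_assoc, sub_self]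

/-- The antipode formula moves the coproduct from `b` onto `a`, where right invariance of `ψ`
applies. Hence multiplying by `(φ ⊗ ι)Δ(b)` inside `φ` gives `φ(b) ψ`. -/
theorem φ_rmul_mulSliceL (a b : A) : H.φ ((H.mulSliceL H.φ b).rmul a) = H.φ b * H.ψ a := by
  rw [H.rmul_mulSliceL, ← sliceR_sliceL_comm, ← H.S_slice, ← ψ_apply, sliceR_sliceL_comm,
    sliceL_ψ_comulR₂, map_smul, smul_eq_mul, mul_comm]

theorem ψ_rmul_mulSliceR (x y : A) : H.ψ ((H.mulSliceR H.ψ x).rmul y) = H.ψ x * H.φ y := by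
  rw [H.rmul_mulSliceR, sliceR_sliceL_comm, H.ψ_apply (sliceL _ _), S_sliceL_ψ_comulL₁,
    ← sliceR_sliceL_comm, sliceR_φ_comulR₁, map_smul, smul_eq_mul, mul_comm]

theorem eq_of_φ_rmul {m n : Multiplier A} (h : ∀ a, H.φ (m.rmul a) = H.φ (n.rmul a)) :
    m = n := by
  have := H.nondeg
  refine ext_rmul fun a => sub_eq_zero.1 (H.φ_faithful_right _ fun b => ?_)
  rw [mul_sub, map_sub, ← rmul_mul, ← rmul_mul, h, sub_self]

theorem eq_of_ψ_rmul {m n : Multiplier A} (h : ∀ a, H.ψ (m.rmul a) = H.ψ (n.rmul a)) :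
    m = n := by
  have := H.nondeg
  refine ext_rmul fun a => sub_eq_zero.1 (H.ψ_faithful_right _ fun b => ?_)
  rw [mul_sub, map_sub, ← rmul_mul, ← rmul_mul, h, sub_self]

/-- The normalized slices of `Δ` by `φ` and by `ψ` convert the two integrals into each other, and
faithfulness makes them mutually inverse multipliers. As `ψ = φ ∘ S` with `S` anti-multiplicative,
`σ' = S⁻¹ σ⁻¹ S`. -/
theorem nonempty_modularData : Nonempty H.ModularData := by
  obtain ⟨e, he⟩ := H.exists_φ_eq_one
  have he' : H.ψ (H.S.symm e) = 1 := by rw [ψ_apply, LinearEquiv.apply_symm_apply, he]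
  have h1 : ∀ a, H.φ ((H.mulSliceL H.φ e).rmul a) = H.ψ a := fun a => by
    rw [φ_rmul_mulSliceL, he, one_mul]
  have h2 : ∀ a, H.ψ ((H.mulSliceR H.ψ (H.S.symm e)).rmul a) = H.φ a := fun a => by
    rw [ψ_rmul_mulSliceR, he', one_mul]
  let δ : (Multiplier A)ˣ :=
    { val := H.mulSliceL H.φ e
      inv := H.mulSliceR H.ψ (H.S.symm e)
      val_inv := H.eq_of_ψ_rmul fun a => by rw [rmul_mul_apply, h2, h1, rmul_one]
      inv_val := H.eq_of_φ_rmul fun a => by rw [rmul_mul_apply, h1, h2, rmul_one] }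
  refine ⟨{
    δ := δ
    φ_slice := fun a => H.eq_of_φ_rmul fun b => ?_
    ψ_slice := fun a => H.eq_of_ψ_rmul fun b => ?_
    φ_S := fun a => (h1 a).symm
    σ := H.modAut
    σ_mul := H.modAut_mul
    φ_mul := H.φ_mul_modAut
    σ' := (H.S.trans H.modAut.symm).trans H.S.symm
    σ'_mul := fun a b => ?_
    ψ_mul := fun a b => ?_ }⟩
  · rw [φ_rmul_mulSliceL, rmul_smul, map_smul, smul_eq_mul, ← h1]
  · rw [ψ_rmul_mulSliceR, rmul_smul, map_smul, smul_eq_mul, ← h2]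
    rfl
  · have h3 : ∀ x y, H.modAut.symm (x * y) = H.modAut.symm x * H.modAut.symm y := fun x y =>
      H.modAut.injective (by simp [modAut_mul])
    simp [H.S_mul, h3, S_symm_mul]
  · rw [ψ_mul_eq, ψ_mul_eq]
    simp [H.φ_mul_modAut (H.modAut.symm _)]

theorem subsingleton_modularData : Subsingleton H.ModularData := by
  refine ⟨fun M N => ModularData.ext ?_ ?_ ?_⟩
  · obtain ⟨e, he⟩ := H.exists_φ_eq_one
    refine Units.ext ?_
    have h := (M.φ_slice e).symm.trans (N.φ_slice e)
    rwa [he, one_smul, one_smul] at h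
  · refine LinearEquiv.ext fun a => sub_eq_zero.1 (H.φ_faithful_right _ fun b => ?_)
    rw [mul_sub, map_sub, ← M.φ_mul, ← N.φ_mul, sub_self]
  · refine LinearEquiv.ext fun a => sub_eq_zero.1 (H.ψ_faithful_right _ fun b => ?_)
    rw [mul_sub, map_sub, ← M.ψ_mul, ← N.ψ_mul, sub_self]

end QuantumHypergroup

/-- The pairing of two spaces of functionals with the tensor product separates points. -/
theorem dualDistrib_map_injective {V W X Y : Type*} [AddCommGroup V] [Module ℂ V]
    [AddCommGroup W] [Module ℂ W] [AddCommGroup X] [Module ℂ X] [AddCommGroup Y] [Module ℂ Y]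
    {p : V →ₗ[ℂ] Module.Dual ℂ X} {q : W →ₗ[ℂ] Module.Dual ℂ Y}
    (hp : Function.Injective p) (hq : Function.Injective q) :
    Function.Injective (TensorProduct.dualDistrib ℂ X Y ∘ₗ TensorProduct.map p q) := by
  classical
  rw [injective_iff_map_eq_zero]
  intro t ht
  -- Expanding the second factor in a basis, `ev x` evaluates the first factor at `x`. Injectivity
  -- of `q` kills `ev x t` for every `x`, and injectivity of `p` then kills each coefficient.
  let b := Module.Basis.ofVectorSpace ℂ W
  let ev : X → V ⊗[ℂ] W →ₗ[ℂ] W := fun x =>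
    (TensorProduct.lid ℂ W).toLinearMap ∘ₗ (Module.Dual.eval ℂ X x ∘ₗ p).rTensor W
  have h1 : ∀ x y s, q (ev x s) y =
      (TensorProduct.dualDistrib ℂ X Y ∘ₗ TensorProduct.map p q) s (x ⊗ₜ[ℂ] y) := by
    intro x y s
    induction s with
    | zero => simp
    | add u v hu hv => simp only [map_add, LinearMap.add_apply, hu, hv]
    | tmul v w => simp [ev]
  have h2 : ∀ x, ev x t = 0 := fun x => hq (LinearMap.ext fun y => by
    rw [h1, ht, map_zero, LinearMap.zero_apply, LinearMap.zero_apply])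
  have h3 : ∀ x s i, b.coord i (ev x s) =
      p (TensorProduct.equivFinsuppOfBasisRight (M := V) b s i) x := by
    intro x s i
    induction s with
    | zero => simp
    | add u v hu hv => simp only [map_add, LinearMap.add_apply, hu, hv, Finsupp.add_apply]
    | tmul v w => simp [ev, mul_comm]
  apply (TensorProduct.equivFinsuppOfBasisRight (M := V) b).injective
  ext i
  rw [map_zero]
  refine hp (LinearMap.ext fun x => ?_)
  rw [← h3, h2]
  simp

/-! ### The algebra `Â`, its actions on `A`, and its counit, integral and antipode. -/

namespace QuantumHypergroup

open Multiplier

variable {A : Type*} [NonUnitalRing A] [Module ℂ A] [IsScalarTower ℂ A A] [SMulCommClass ℂ A A]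
  (H : QuantumHypergroup A)

theorem dual_ext {ω ω' : H.dual}
    (h : ∀ x, (ω : Module.Dual ℂ A) x = (ω' : Module.Dual ℂ A) x) : ω = ω' :=
  Subtype.ext (LinearMap.ext h)

theorem comp_S_mem_dual (ω : H.dual) :
    (ω : Module.Dual ℂ A) ∘ₗ H.S.toLinearMap ∈ H.dual := by
  obtain ⟨c, rfl⟩ := H.toDual.surjective ω
  obtain ⟨b, hb⟩ := H.exists_ψ_mul_left_eq_φ_mul (H.S.symm c)
  refine ⟨b, LinearMap.ext fun x => ?_⟩
  rw [toFunctional_apply, hb, ψ_mul_eq]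
  simp [toDual_apply]

/-- The map `ω ↦ ω ∘ S` on `Â`, as a linear map. -/
def dualSMap : H.dual →ₗ[ℂ] H.dual :=
  (H.S.toLinearMap.lcomp ℂ ℂ ∘ₗ H.dual.subtype).codRestrict H.dual H.comp_S_mem_dual

theorem dualSMap_apply (ω : H.dual) (x : A) :
    (H.dualSMap ω : Module.Dual ℂ A) x = (ω : Module.Dual ℂ A) (H.S x) := rfl

theorem dualSMap_bijective : Function.Bijective H.dualSMap := by
  refine ⟨fun ω ω' h => H.dual_ext fun x => ?_, fun ω => ?_⟩
  · rw [← H.S.apply_symm_apply x, ← dualSMap_apply, h, dualSMap_apply]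
  · obtain ⟨c, rfl⟩ := H.toDual.surjective ω
    obtain ⟨b, hb⟩ := H.exists_φ_mul_eq_ψ_mul_left c
    refine ⟨H.toDual (H.S b), H.dual_ext fun x => ?_⟩
    rw [dualSMap_apply, toDual_apply, toDual_apply, hb, ψ_mul_eq]

/-- The antipode `ω ↦ ω ∘ S` of `Â`. -/
def dualS : H.dual ≃ₗ[ℂ] H.dual := LinearEquiv.ofBijective _ H.dualSMap_bijective

theorem dualS_apply (ω : H.dual) (x : A) :
    (H.dualS ω : Module.Dual ℂ A) x = (ω : Module.Dual ℂ A) (H.S x) := rfl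

theorem dualS_symm_apply (ω : H.dual) (x : A) :
    (H.dualS.symm ω : Module.Dual ℂ A) x = (ω : Module.Dual ℂ A) (H.S.symm x) := by
  obtain ⟨ω, rfl⟩ := H.dualS.surjective ω
  rw [LinearEquiv.symm_apply_apply, dualS_apply, LinearEquiv.apply_symm_apply]

/-- The linear bijection `a ↦ ψ(a ·)` of `A` onto `Â`. -/
def leftDualψ : A ≃ₗ[ℂ] H.dual := (H.S.trans H.toDual).trans H.dualS

theorem leftDualψ_apply (a x : A) : (H.leftDualψ a : Module.Dual ℂ A) x = H.ψ (a * x) := by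
  simp [leftDualψ, dualS_apply, toDual_apply, ψ_mul_eq]

/-- The map `x ↦ (ι ⊗ ω)Δ(x)`, with values in `A`. -/
def actR : H.dual →ₗ[ℂ] A →ₗ[ℂ] A :=
  (H.comulR₂.compr₂ (sliceR H.φ)).flip ∘ₗ H.toDual.symm.toLinearMap

/-- The map `x ↦ (ω ⊗ ι)Δ(x)`, with values in `A`. -/
def actL : H.dual →ₗ[ℂ] A →ₗ[ℂ] A :=
  (H.comulR₁.compr₂ (sliceL H.φ)).flip ∘ₗ H.toDual.symm.toLinearMap

theorem actR_toDual (c x : A) : H.actR (H.toDual c) x = sliceR H.φ (H.comulR₂ x c) := by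
  simp [actR]

theorem actL_toDual (c x : A) : H.actL (H.toDual c) x = sliceL H.φ (H.comulR₁ x c) := by
  simp [actL]

theorem coe_toDual (c : A) :
    (H.toDual c : Module.Dual ℂ A) = H.φ ∘ₗ LinearMap.mulRight ℂ c := rfl

theorem coe_leftDual (c : A) :
    (H.leftDual c : Module.Dual ℂ A) = H.φ ∘ₗ LinearMap.mulLeft ℂ c := rfl

theorem coe_leftDualψ (c : A) :
    (H.leftDualψ c : Module.Dual ℂ A) = H.ψ ∘ₗ LinearMap.mulLeft ℂ c :=
  LinearMap.ext (H.leftDualψ_apply c)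

/-- Characterizes `(ι ⊗ ω)Δ(x)` by `ω` alone, independently of the element representing `ω`; any
other cover of `ω` therefore computes it too. -/
theorem mul_actR (ω : H.dual) (x c : A) :
    c * H.actR ω x = sliceR (ω : Module.Dual ℂ A) (H.comulL₁ x c) := by
  obtain ⟨b, rfl⟩ := H.toDual.surjective ω
  rw [actR_toDual, mul_sliceR_comulR₂]

theorem mul_actL (ω : H.dual) (x c : A) :
    c * H.actL ω x = sliceL (ω : Module.Dual ℂ A) (H.comulL₂ x c) := by
  obtain ⟨b, rfl⟩ := H.toDual.surjective ω
  rw [actL_toDual, H.mul_sliceL_comulR₁, coe_toDual]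

section Cover

variable {H} {g : Module.Dual ℂ A} {ω : H.dual} {b : A}

theorem actR_eq_sliceR_comulR₂ (h : (ω : Module.Dual ℂ A) = g ∘ₗ LinearMap.mulRight ℂ b) (x : A) :
    H.actR ω x = sliceR g (H.comulR₂ x b) := by
  have := H.nondeg
  refine sub_eq_zero.1 (NondegMul.right _ fun c => ?_)
  rw [mul_sub, mul_actR, H.toPreComul.mul_sliceR_comulR₂, h, sub_self]

theorem actL_eq_sliceL_comulL₁ (h : (ω : Module.Dual ℂ A) = g ∘ₗ LinearMap.mulLeft ℂ b) (x : A) :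
    H.actL ω x = sliceL g (H.comulL₁ x b) := by
  have := H.nondeg
  refine sub_eq_zero.1 (NondegMul.right _ fun c => ?_)
  rw [mul_sub, mul_actL, H.mul_sliceL_comulL₁, h, sub_self]

end Cover

theorem mul_apply_actR (ω ω' : H.dual) (x : A) :
    ((ω * ω' : H.dual) : Module.Dual ℂ A) x = (ω : Module.Dual ℂ A) (H.actR ω' x) := rfl

/-- Both sides are `(ω ⊗ ω')Δ(x)`. With its counterpart for `actR` it makes the product of `Â`
transpose to the two actions, so associativity gives the module laws and their commutation. -/
theorem mul_apply_actL (ω ω' : H.dual) (x : A) :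
    ((ω * ω' : H.dual) : Module.Dual ℂ A) x = (ω' : Module.Dual ℂ A) (H.actL ω x) := by
  obtain ⟨b, rfl⟩ := H.toDual.surjective ω
  obtain ⟨a, rfl⟩ := H.toDual.surjective ω'
  rw [mul_apply_actR, actR_toDual, actL_toDual, toDual_apply, toDual_apply,
    H.apply_sliceR_comulR₂_mul]

theorem eq_of_dual {x y : A} (h : ∀ ω : H.dual, (ω : Module.Dual ℂ A) x =
    (ω : Module.Dual ℂ A) y) : x = y := by
  refine sub_eq_zero.1 (H.φ_faithful_left _ fun b => ?_)
  rw [sub_mul, map_sub, ← toDual_apply, ← toDual_apply, h, sub_self]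

theorem actR_mul_apply (ω ω' : H.dual) (x : A) :
    H.actR (ω * ω') x = H.actR ω (H.actR ω' x) := by
  refine H.eq_of_dual fun ρ => ?_
  rw [← mul_apply_actR, ← mul_apply_actR, ← mul_apply_actR, mul_assoc]

theorem actL_mul_apply (ω ω' : H.dual) (x : A) :
    H.actL (ω * ω') x = H.actL ω' (H.actL ω x) := by
  refine H.eq_of_dual fun ρ => ?_
  rw [← mul_apply_actL, ← mul_apply_actL, ← mul_apply_actL, mul_assoc]

theorem actL_actR (ω ω' : H.dual) (x : A) :
    H.actL ω (H.actR ω' x) = H.actR ω' (H.actL ω x) := by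
  refine H.eq_of_dual fun ρ => ?_
  rw [← mul_apply_actL, ← mul_apply_actR, ← mul_apply_actR, ← mul_apply_actL, mul_assoc]

theorem counit_actR (ω : H.dual) (x : A) : H.counit (H.actR ω x) = (ω : Module.Dual ℂ A) x := by
  obtain ⟨b, rfl⟩ := H.toDual.surjective ω
  rw [actR_toDual, sliceR_sliceL_comm, sliceL_counit_comulR₂, toDual_apply]

theorem S_actR_toDual (c x : A) : H.S (H.actR (H.toDual c) x) = sliceR H.φ (H.comulL₂ c x) := by
  rw [actR_toDual, H.S_slice]

theorem S_actL_leftDualψ (c x : A) :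
    H.S (H.actL (H.leftDualψ c) x) = sliceL H.ψ (H.comulR₁ c x) := by
  rw [actL_eq_sliceL_comulL₁ (H.coe_leftDualψ c), S_sliceL_ψ_comulL₁]

theorem S_actR_dualS (ω : H.dual) (x : A) : H.S (H.actR (H.dualS ω) x) = H.actL ω (H.S x) := by
  obtain ⟨b, rfl⟩ := H.leftDual.surjective ω
  obtain ⟨b, rfl⟩ := H.S.surjective b
  have h : (H.dualS (H.leftDual (H.S b)) : Module.Dual ℂ A) =
      H.ψ ∘ₗ LinearMap.mulRight ℂ b := LinearMap.ext fun x => by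
    simp [dualS_apply, leftDual_apply, ψ_mul_eq]
  rw [actR_eq_sliceR_comulR₂ h, actL_eq_sliceL_comulL₁ (H.coe_leftDual _), comulL₁_S,
    sliceL_flipS]
  rfl

theorem dualS_mul (ω ω' : H.dual) : H.dualS (ω * ω') = H.dualS ω' * H.dualS ω := by
  refine H.dual_ext fun x => ?_
  rw [dualS_apply, mul_apply_actL, mul_apply_actR, dualS_apply, S_actR_dualS]

/-- The counit `φ(· a) ↦ φ(a)` of `Â`. -/
def dualCounit : Module.Dual ℂ H.dual := H.φ ∘ₗ H.toDual.symm.toLinearMap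

theorem dualCounit_toDual (a : A) : H.dualCounit (H.toDual a) = H.φ a := by simp [dualCounit]

/-- Left invariance: `φ` is an eigenvector of the right action with eigenvalue `ε̂`, which is why
`ε̂` is multiplicative and also sends `φ(a ·)` to `φ(a)`. -/
theorem φ_actL (ω : H.dual) (x : A) : H.φ (H.actL ω x) = H.φ x * H.dualCounit ω := by
  obtain ⟨b, rfl⟩ := H.toDual.surjective ω
  rw [actL_toDual, ← sliceR_sliceL_comm, sliceR_φ_comulR₁, map_smul, smul_eq_mul,
    dualCounit_toDual]

theorem dualCounit_leftDual (a : A) : H.dualCounit (H.leftDual a) = H.φ a := by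
  obtain ⟨e, he⟩ := H.exists_φ_eq_one
  have h := H.φ_actL (H.leftDual a) e
  rwa [actL_eq_sliceL_comulL₁ (H.coe_leftDual _), ← sliceR_sliceL_comm, sliceR_φ_comulL₁, map_smul,
    smul_eq_mul, he, one_mul, one_mul, eq_comm] at h

theorem dualCounit_mul (ω ω' : H.dual) :
    H.dualCounit (ω * ω') = H.dualCounit ω * H.dualCounit ω' := by
  obtain ⟨e, he⟩ := H.exists_φ_eq_one
  have h := H.φ_actL (ω * ω') e
  rwa [actL_mul_apply, φ_actL, φ_actL, he, one_mul, one_mul, eq_comm] at h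

/-- The functional `x ↦ ω(x c)`. -/
def smulL (c : A) : H.dual →ₗ[ℂ] H.dual :=
  H.toDual.toLinearMap ∘ₗ LinearMap.mulLeft ℂ c ∘ₗ H.toDual.symm.toLinearMap

/-- The functional `x ↦ ω(c x)`. -/
def smulR (c : A) : H.dual →ₗ[ℂ] H.dual :=
  H.leftDual.toLinearMap ∘ₗ LinearMap.mulRight ℂ c ∘ₗ H.leftDual.symm.toLinearMap

theorem smulL_apply (c : A) (ω : H.dual) (x : A) :
    (H.smulL c ω : Module.Dual ℂ A) x = (ω : Module.Dual ℂ A) (x * c) := by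
  obtain ⟨b, rfl⟩ := H.toDual.surjective ω
  simp [smulL, toDual_apply, mul_assoc]

theorem smulR_apply (c : A) (ω : H.dual) (x : A) :
    (H.smulR c ω : Module.Dual ℂ A) x = (ω : Module.Dual ℂ A) (c * x) := by
  obtain ⟨b, rfl⟩ := H.leftDual.surjective ω
  simp [smulR, leftDual_apply, mul_assoc]

theorem dualCounit_smulL (c : A) (ω : H.dual) :
    H.dualCounit (H.smulL c ω) = (ω : Module.Dual ℂ A) c := by
  obtain ⟨b, rfl⟩ := H.toDual.surjective ω
  simp [smulL, toDual_apply, dualCounit_toDual]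

theorem dualCounit_smulR (c : A) (ω : H.dual) :
    H.dualCounit (H.smulR c ω) = (ω : Module.Dual ℂ A) c := by
  obtain ⟨b, rfl⟩ := H.leftDual.surjective ω
  simp [smulR, leftDual_apply, dualCounit_leftDual]

/-- The left integral `ψ(a ·) ↦ ε(a)` of `Â`. -/
def dualφ : Module.Dual ℂ H.dual := H.counit ∘ₗ H.leftDualψ.symm.toLinearMap

theorem dualφ_leftDualψ (a : A) : H.dualφ (H.leftDualψ a) = H.counit a := by
  simp [dualφ]

theorem smulR_leftDualψ (c a : A) : H.smulR c (H.leftDualψ a) = H.leftDualψ (a * c) :=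
  H.dual_ext fun x => by simp [smulR_apply, leftDualψ_apply, mul_assoc]

theorem dualφ_smulR (c : A) (ω : H.dual) : H.dualφ (H.smulR c ω) = H.dualφ ω * H.counit c := by
  obtain ⟨b, rfl⟩ := H.leftDualψ.surjective ω
  rw [smulR_leftDualψ, dualφ_leftDualψ, dualφ_leftDualψ, counit_mul]

/-- The antipode formula of `ψ` moves the coproduct from the argument onto `c`: the functionals `ψ(c
·)` form a right ideal with an explicit action on `c`. -/
theorem leftDualψ_mul (c : A) (ω : H.dual) :
    H.leftDualψ c * ω = H.leftDualψ (H.actR (H.dualS.symm ω) c) := by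
  refine H.dual_ext fun x => ?_
  obtain ⟨ω, rfl⟩ := H.dualS.surjective ω
  obtain ⟨b, rfl⟩ := H.toDual.surjective ω
  rw [mul_apply_actL, LinearEquiv.symm_apply_apply, dualS_apply, S_actL_leftDualψ, toDual_apply,
    ← H.apply_sliceR_comulR₂_mul, leftDualψ_apply, actR_toDual]

/-- Applying `φ̂` recovers the value of `ω` at an arbitrary point, so products in `Â` under `φ̂`
separate both factors. -/
theorem dualφ_leftDualψ_mul (c : A) (ω : H.dual) :
    H.dualφ (H.leftDualψ c * ω) = (ω : Module.Dual ℂ A) (H.S.symm c) := by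
  rw [leftDualψ_mul, dualφ_leftDualψ, counit_actR, dualS_symm_apply]

instance instNondegMulDual : NondegMul H.dual where
  left ω h := by
    obtain ⟨b, rfl⟩ := H.leftDualψ.surjective ω
    have hb : H.S.symm b = 0 := H.eq_of_dual fun ω => by
      rw [← dualφ_leftDualψ_mul, h, map_zero, map_zero]
    simp at hb
    rw [hb, map_zero]
  right ω h := H.dual_ext fun x => by
    obtain ⟨c, rfl⟩ := H.S.symm.surjective x
    rw [← dualφ_leftDualψ_mul, h]
    simp

end QuantumHypergroup

/-! ### The comultiplication of `Â`. -/

namespace QuantumHypergroup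

open Multiplier

variable {A : Type*} [NonUnitalRing A] [Module ℂ A] [IsScalarTower ℂ A A] [SMulCommClass ℂ A A]
  (H : QuantumHypergroup A)

theorem pairing_injective : Function.Injective H.pairing :=
  dualDistrib_map_injective H.dual.subtype_injective H.dual.subtype_injective

theorem pairing_ext {s t : H.dual ⊗[ℂ] H.dual}
    (h : ∀ x y, H.pairing s (x ⊗ₜ[ℂ] y) = H.pairing t (x ⊗ₜ[ℂ] y)) : s = t :=
  H.pairing_injective (TensorProduct.ext' h)

/-- Evaluation at `x` as a functional on `Â`. -/
def ev (x : A) : Module.Dual ℂ H.dual := Module.Dual.eval ℂ A x ∘ₗ H.dual.subtype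

theorem ev_apply (x : A) (ω : H.dual) : H.ev x ω = (ω : Module.Dual ℂ A) x := rfl

theorem sliceR_ev_apply (t : H.dual ⊗[ℂ] H.dual) (x y : A) :
    (sliceR (H.ev y) t : Module.Dual ℂ A) x = H.pairing t (x ⊗ₜ[ℂ] y) := by
  induction t with
  | zero => simp
  | add s t hs ht => simp only [map_add, Submodule.coe_add, LinearMap.add_apply, hs, ht]
  | tmul p q => simp [pairing_tmul, ev_apply, mul_comm]

theorem sliceL_ev_apply (t : H.dual ⊗[ℂ] H.dual) (x y : A) :
    (sliceL (H.ev x) t : Module.Dual ℂ A) y = H.pairing t (x ⊗ₜ[ℂ] y) := by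
  induction t with
  | zero => simp
  | add s t hs ht => simp only [map_add, Submodule.coe_add, LinearMap.add_apply, hs, ht]
  | tmul p q => simp [pairing_tmul, ev_apply]

theorem sliceL_apply (f : Module.Dual ℂ H.dual) (t : H.dual ⊗[ℂ] H.dual) (y : A) :
    (sliceL f t : Module.Dual ℂ A) y = f (sliceR (H.ev y) t) :=
  (sliceR_sliceL_comm f (H.ev y) t).symm

theorem sliceR_apply (f : Module.Dual ℂ H.dual) (t : H.dual ⊗[ℂ] H.dual) (x : A) :
    (sliceR f t : Module.Dual ℂ A) x = f (sliceL (H.ev x) t) :=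
  sliceR_sliceL_comm (H.ev x) f t

theorem pairing_map {F G : H.dual →ₗ[ℂ] H.dual} {F' G' : A →ₗ[ℂ] A}
    (hF : ∀ ω x, (F ω : Module.Dual ℂ A) x = (ω : Module.Dual ℂ A) (F' x))
    (hG : ∀ ω x, (G ω : Module.Dual ℂ A) x = (ω : Module.Dual ℂ A) (G' x))
    (t : H.dual ⊗[ℂ] H.dual) (x y : A) :
    H.pairing (TensorProduct.map F G t) (x ⊗ₜ[ℂ] y) = H.pairing t (F' x ⊗ₜ[ℂ] G' y) := by
  induction t with
  | zero => simp
  | add s t hs ht => simp only [map_add, LinearMap.add_apply, hs, ht]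
  | tmul p q => simp [pairing_tmul, hF, hG]

section Existence

theorem exists_pairing_right₂ (ω ω₂ : H.dual) : ∃ t, ∀ x y, H.pairing t (x ⊗ₜ[ℂ] y) =
    (ω : Module.Dual ℂ A) (x * H.actR ω₂ y) := by
  obtain ⟨b, rfl⟩ := H.toDual.surjective ω
  obtain ⟨c, rfl⟩ := H.toDual.surjective ω₂
  -- With `ω = φ(· b)` and `ω₂ = φ(· c)`, applying `S` to `(ι ⊗ ω₂)Δ(y) · b` gives `(ι ⊗ φ)((S(b) ⊗
  -- y)Δ(c))`. Undoing `S` on the first leg of `(S(b) ⊗ 1)Δ(c)` gives the witness.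
  refine ⟨TensorProduct.map (H.toDual.toLinearMap ∘ₗ H.S.symm.toLinearMap) H.toDual.toLinearMap
    (H.comulL₁ c (H.S b)), fun x y => ?_⟩
  have h : ∀ t, H.pairing (TensorProduct.map (H.toDual.toLinearMap ∘ₗ H.S.symm.toLinearMap)
      H.toDual.toLinearMap t) (x ⊗ₜ[ℂ] y) =
      H.φ (x * H.S.symm (sliceR H.φ ((leg₂ y).lmul t))) := by
    intro t
    induction t with
    | zero => simp
    | add s t hs ht => simp only [map_add, LinearMap.add_apply, hs, ht, mul_add]
    | tmul p q => simp [pairing_tmul, toDual_apply, mul_smul_comm, mul_comm]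
  rw [h, ← H.leg₁_lmul_comulL₂, sliceR_leg₁_lmul, ← S_actR_toDual, ← H.S_mul,
    LinearEquiv.symm_apply_apply, toDual_apply, mul_assoc]

/-- Mirror image of the preceding construction, with the antipode formula of `ψ` in place of that of
`φ`. -/
theorem exists_pairing_left₁ (ω ω₁ : H.dual) : ∃ t, ∀ x y, H.pairing t (x ⊗ₜ[ℂ] y) =
    (ω : Module.Dual ℂ A) (H.actL ω₁ x * y) := by
  obtain ⟨b, rfl⟩ := H.leftDual.surjective ω
  obtain ⟨c, rfl⟩ := H.leftDualψ.surjective ω₁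
  refine ⟨TensorProduct.map H.leftDualψ.toLinearMap (H.leftDual.toLinearMap ∘ₗ
    H.S.symm.toLinearMap) (H.comulR₂ c (H.S b)), fun x y => ?_⟩
  have h : ∀ t, H.pairing (TensorProduct.map H.leftDualψ.toLinearMap (H.leftDual.toLinearMap ∘ₗ
      H.S.symm.toLinearMap) t) (x ⊗ₜ[ℂ] y) =
      H.φ (H.S.symm (sliceL H.ψ ((leg₁ x).rmul t)) * y) := by
    intro t
    induction t with
    | zero => simp
    | add s t hs ht => simp only [map_add, LinearMap.add_apply, hs, ht, add_mul]
    | tmul p q => simp [pairing_tmul, leftDual_apply, leftDualψ_apply, smul_mul_assoc]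
  rw [h, H.leg₁_rmul_comulR₂, sliceL_leg₂_rmul, ← S_actL_leftDualψ, ← H.S_mul,
    LinearEquiv.symm_apply_apply, leftDual_apply, mul_assoc]

theorem exists_pairing_left₂ (ω ω₂ : H.dual) : ∃ t, ∀ x y, H.pairing t (x ⊗ₜ[ℂ] y) =
    (ω : Module.Dual ℂ A) (x * H.actL ω₂ y) := by
  obtain ⟨b, rfl⟩ := H.toDual.surjective ω
  obtain ⟨c, rfl⟩ := H.leftDualψ.surjective ω₂
  let F := TensorProduct.map (H.toDual.toLinearMap ∘ₗ H.S.symm.toLinearMap)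
    H.leftDualψ.toLinearMap ∘ₗ (TensorProduct.comm ℂ A A).toLinearMap
  refine ⟨F (H.comulL₂ c (H.S b)), fun x y => ?_⟩
  have h : ∀ t, H.pairing (F t) (x ⊗ₜ[ℂ] y) =
      H.φ (x * H.S.symm (sliceL H.ψ ((leg₁ y).rmul t))) := by
    intro t
    induction t with
    | zero => simp
    | add s t hs ht => simp only [map_add, LinearMap.add_apply, hs, ht, mul_add]
    | tmul p q => simp [F, pairing_tmul, toDual_apply, leftDualψ_apply, mul_smul_comm, mul_comm]
  rw [h, ← H.leg₂_lmul_comulR₁, sliceL_leg₂_lmul, ← S_actL_leftDualψ, ← H.S_mul,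
    LinearEquiv.symm_apply_apply, toDual_apply, mul_assoc]

theorem exists_pairing_right₁ (ω ω₁ : H.dual) : ∃ t, ∀ x y, H.pairing t (x ⊗ₜ[ℂ] y) =
    (ω : Module.Dual ℂ A) (H.actR ω₁ x * y) := by
  obtain ⟨b, rfl⟩ := H.leftDual.surjective ω
  obtain ⟨c, rfl⟩ := H.toDual.surjective ω₁
  let F := TensorProduct.map H.toDual.toLinearMap (H.leftDual.toLinearMap ∘ₗ
    H.S.symm.toLinearMap) ∘ₗ (TensorProduct.comm ℂ A A).toLinearMap
  refine ⟨F (H.comulR₁ c (H.S b)), fun x y => ?_⟩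
  have h : ∀ t, H.pairing (F t) (x ⊗ₜ[ℂ] y) =
      H.φ (H.S.symm (sliceR H.φ ((leg₂ x).lmul t)) * y) := by
    intro t
    induction t with
    | zero => simp
    | add s t hs ht => simp only [map_add, LinearMap.add_apply, hs, ht, add_mul]
    | tmul p q => simp [F, pairing_tmul, toDual_apply, leftDual_apply, smul_mul_assoc]
  rw [h, H.leg₂_lmul_comulR₁, sliceR_leg₁_rmul, ← S_actR_toDual, ← H.S_mul,
    LinearEquiv.symm_apply_apply, leftDual_apply, mul_assoc]

end Existence

section TensorActions

/-- The left action of `Â ⊗ Â` on `A ⊗ A`. -/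
def actR₂ : H.dual ⊗[ℂ] H.dual →ₗ[ℂ] A ⊗[ℂ] A →ₗ[ℂ] A ⊗[ℂ] A := TensorProduct.map₂ H.actR H.actR

/-- The right action of `Â ⊗ Â` on `A ⊗ A`. -/
def actL₂ : H.dual ⊗[ℂ] H.dual →ₗ[ℂ] A ⊗[ℂ] A →ₗ[ℂ] A ⊗[ℂ] A := TensorProduct.map₂ H.actL H.actL

@[simp] theorem actR₂_tmul (ω ω' : H.dual) (x y : A) :
    H.actR₂ (ω ⊗ₜ[ℂ] ω') (x ⊗ₜ[ℂ] y) = H.actR ω x ⊗ₜ[ℂ] H.actR ω' y := by simp [actR₂]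

@[simp] theorem actL₂_tmul (ω ω' : H.dual) (x y : A) :
    H.actL₂ (ω ⊗ₜ[ℂ] ω') (x ⊗ₜ[ℂ] y) = H.actL ω x ⊗ₜ[ℂ] H.actL ω' y := by simp [actL₂]

theorem actR₂_mul (s t : H.dual ⊗[ℂ] H.dual) (z : A ⊗[ℂ] A) :
    H.actR₂ (s * t) z = H.actR₂ s (H.actR₂ t z) := by
  induction s with
  | zero => simp
  | add s s' h h' => simp only [add_mul, map_add, LinearMap.add_apply, h, h']
  | tmul p q =>
    induction t with
    | zero => simp
    | add t t' h h' => simp only [mul_add, map_add, LinearMap.add_apply, h, h']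
    | tmul p' q' =>
      induction z with
      | zero => simp
      | add z z' h h' => simp only [map_add, h, h']
      | tmul x y => simp [actR_mul_apply]

theorem actL₂_mul (s t : H.dual ⊗[ℂ] H.dual) (z : A ⊗[ℂ] A) :
    H.actL₂ (s * t) z = H.actL₂ t (H.actL₂ s z) := by
  induction s with
  | zero => simp
  | add s s' h h' => simp only [add_mul, map_add, LinearMap.add_apply, h, h']
  | tmul p q =>
    induction t with
    | zero => simp
    | add t t' h h' => simp only [mul_add, map_add, LinearMap.add_apply, h, h']
    | tmul p' q' =>
      induction z with
      | zero => simp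
      | add z z' h h' => simp only [map_add, h, h']
      | tmul x y => simp [actL_mul_apply]

theorem actL₂_actR₂ (s t : H.dual ⊗[ℂ] H.dual) (z : A ⊗[ℂ] A) :
    H.actL₂ s (H.actR₂ t z) = H.actR₂ t (H.actL₂ s z) := by
  induction s with
  | zero => simp
  | add s s' h h' => simp only [map_add, LinearMap.add_apply, h, h']
  | tmul p q =>
    induction t with
    | zero => simp
    | add t t' h h' => simp only [map_add, LinearMap.add_apply, h, h']
    | tmul p' q' =>
      induction z with
      | zero => simp
      | add z z' h h' => simp only [map_add, h, h']
      | tmul x y => simp [actL_actR]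

theorem pairing_mul_actR₂ (s t : H.dual ⊗[ℂ] H.dual) (z : A ⊗[ℂ] A) :
    H.pairing (s * t) z = H.pairing s (H.actR₂ t z) := by
  induction s with
  | zero => simp
  | add s s' h h' => simp only [add_mul, map_add, LinearMap.add_apply, h, h']
  | tmul p q =>
    induction t with
    | zero => simp
    | add t t' h h' => simp only [mul_add, map_add, LinearMap.add_apply, h, h']
    | tmul p' q' =>
      induction z with
      | zero => simp
      | add z z' h h' => simp only [map_add, h, h']
      | tmul x y => simp [pairing_tmul, mul_apply_actR]

theorem pairing_mul_actL₂ (s t : H.dual ⊗[ℂ] H.dual) (z : A ⊗[ℂ] A) :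
    H.pairing (s * t) z = H.pairing t (H.actL₂ s z) := by
  induction s with
  | zero => simp
  | add s s' h h' => simp only [add_mul, map_add, LinearMap.add_apply, h, h']
  | tmul p q =>
    induction t with
    | zero => simp
    | add t t' h h' => simp only [mul_add, map_add, LinearMap.add_apply, h, h']
    | tmul p' q' =>
      induction z with
      | zero => simp
      | add z z' h h' => simp only [map_add, h, h']
      | tmul x y => simp [pairing_tmul, mul_apply_actL]

/-- The functional `z ↦ ω(μ(t z))` on `A ⊗ A`, where `μ` is the product of `A`. -/
def mulActR (ω : H.dual) : H.dual ⊗[ℂ] H.dual →ₗ[ℂ] Module.Dual ℂ (A ⊗[ℂ] A) :=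
  H.actR₂.compr₂ ((ω : Module.Dual ℂ A) ∘ₗ LinearMap.mul' ℂ A)

/-- The functional `z ↦ ω(μ(z t))` on `A ⊗ A`, where `μ` is the product of `A`. -/
def mulActL (ω : H.dual) : H.dual ⊗[ℂ] H.dual →ₗ[ℂ] Module.Dual ℂ (A ⊗[ℂ] A) :=
  H.actL₂.compr₂ ((ω : Module.Dual ℂ A) ∘ₗ LinearMap.mul' ℂ A)

theorem mulActR_apply (ω : H.dual) (t : H.dual ⊗[ℂ] H.dual) (z : A ⊗[ℂ] A) :
    H.mulActR ω t z = (ω : Module.Dual ℂ A) (LinearMap.mul' ℂ A (H.actR₂ t z)) := rfl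

theorem mulActL_apply (ω : H.dual) (t : H.dual ⊗[ℂ] H.dual) (z : A ⊗[ℂ] A) :
    H.mulActL ω t z = (ω : Module.Dual ℂ A) (LinearMap.mul' ℂ A (H.actL₂ t z)) := rfl

/-- For `ω₁ ⊗ ω₂`, one cover by `ω₂` already gives an element of `Â ⊗ Â`; multiplying its first leg
by `ω₁` precomposes the pairing with the action of `ω₁`. -/
theorem mulActR_mem_range (ω : H.dual) (t : H.dual ⊗[ℂ] H.dual) :
    H.mulActR ω t ∈ LinearMap.range H.pairing := by
  induction t with
  | zero => simp
  | add s t hs ht => rw [map_add]; exact add_mem hs ht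
  | tmul ω₁ ω₂ =>
    obtain ⟨t, ht⟩ := H.exists_pairing_right₂ ω ω₂
    refine ⟨TensorProduct.map (LinearMap.mulRight ℂ ω₁) LinearMap.id t,
      TensorProduct.ext' fun x y => ?_⟩
    rw [H.pairing_map (F' := H.actR ω₁) (G' := LinearMap.id) (fun ω x => mul_apply_actR H _ _ x)
      (fun ω x => rfl), ht]
    simp [mulActR_apply]

theorem mulActL_mem_range (ω : H.dual) (t : H.dual ⊗[ℂ] H.dual) :
    H.mulActL ω t ∈ LinearMap.range H.pairing := by
  induction t with
  | zero => simp
  | add s t hs ht => rw [map_add]; exact add_mem hs ht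
  | tmul ω₁ ω₂ =>
    obtain ⟨t, ht⟩ := H.exists_pairing_left₁ ω ω₁
    refine ⟨TensorProduct.map LinearMap.id (LinearMap.mulLeft ℂ ω₂) t,
      TensorProduct.ext' fun x y => ?_⟩
    rw [H.pairing_map (F' := LinearMap.id) (G' := H.actL ω₂) (fun ω x => rfl)
      (fun ω x => mul_apply_actL H _ _ x), ht]
    simp [mulActL_apply]

/-- The lift of a map with values in the functionals that are given by `Â ⊗ Â`. -/
def liftPairing {U : Type*} [AddCommGroup U] [Module ℂ U]
    (F : U →ₗ[ℂ] Module.Dual ℂ (A ⊗[ℂ] A)) (hF : ∀ u, F u ∈ LinearMap.range H.pairing) :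
    U →ₗ[ℂ] H.dual ⊗[ℂ] H.dual :=
  (LinearEquiv.ofInjective _ H.pairing_injective).symm.toLinearMap ∘ₗ F.codRestrict _ hF

theorem pairing_liftPairing {U : Type*} [AddCommGroup U] [Module ℂ U]
    (F : U →ₗ[ℂ] Module.Dual ℂ (A ⊗[ℂ] A)) (hF : ∀ u, F u ∈ LinearMap.range H.pairing) (u : U) :
    H.pairing (H.liftPairing F hF u) = F u :=
  congrArg Subtype.val ((LinearEquiv.ofInjective _ H.pairing_injective).apply_symm_apply
    (F.codRestrict _ hF u))

/-- The multiplier `Δ̂(ω)` of `Â ⊗ Â`. -/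
def dualComulFun (ω : H.dual) : Multiplier (H.dual ⊗[ℂ] H.dual) :=
  ⟨(H.liftPairing (H.mulActR ω) (H.mulActR_mem_range ω),
    MulOpposite.op (H.liftPairing (H.mulActL ω) (H.mulActL_mem_range ω))), by
    refine ⟨fun s t => ?_, fun s t => ?_, fun s t => ?_⟩ <;>
    refine H.pairing_injective (LinearMap.ext fun z => ?_)
    · simp only [pairing_mul_actR₂, pairing_liftPairing, mulActR_apply, actR₂_mul]
    · simp only [MulOpposite.unop_op, pairing_mul_actL₂, pairing_liftPairing, mulActL_apply,
        actL₂_mul]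
    -- Compatibility of the two halves of the multiplier is the commutation of the left and right
    -- actions.
    · simp only [MulOpposite.unop_op]
      rw [pairing_mul_actR₂, pairing_mul_actL₂, pairing_liftPairing, pairing_liftPairing,
        mulActL_apply, mulActR_apply, actL₂_actR₂]⟩

theorem pairing_lmul_dualComulFun (ω : H.dual) (t : H.dual ⊗[ℂ] H.dual) (z : A ⊗[ℂ] A) :
    H.pairing ((H.dualComulFun ω).lmul t) z =
      (ω : Module.Dual ℂ A) (LinearMap.mul' ℂ A (H.actR₂ t z)) :=
  LinearMap.congr_fun (H.pairing_liftPairing _ (H.mulActR_mem_range ω) t) z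

theorem pairing_rmul_dualComulFun (ω : H.dual) (t : H.dual ⊗[ℂ] H.dual) (z : A ⊗[ℂ] A) :
    H.pairing ((H.dualComulFun ω).rmul t) z =
      (ω : Module.Dual ℂ A) (LinearMap.mul' ℂ A (H.actL₂ t z)) :=
  LinearMap.congr_fun (H.pairing_liftPairing _ (H.mulActL_mem_range ω) t) z

/-- The comultiplication of `Â`. -/
def dualComul : H.dual →ₗ[ℂ] Multiplier (H.dual ⊗[ℂ] H.dual) where
  toFun := H.dualComulFun
  map_add' ω ω' := ext_lmul fun t => H.pairing_injective (LinearMap.ext fun z => by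
    change _ = H.pairing ((H.dualComulFun ω).lmul t + (H.dualComulFun ω').lmul t) z
    simp [pairing_lmul_dualComulFun])
  map_smul' r ω := ext_lmul fun t => H.pairing_injective (LinearMap.ext fun z => by
    change _ = H.pairing (r • (H.dualComulFun ω).lmul t) z
    simp [pairing_lmul_dualComulFun])

theorem pairing_lmul_dualComul (ω : H.dual) (t : H.dual ⊗[ℂ] H.dual) (z : A ⊗[ℂ] A) :
    H.pairing ((H.dualComul ω).lmul t) z =
      (ω : Module.Dual ℂ A) (LinearMap.mul' ℂ A (H.actR₂ t z)) :=
  H.pairing_lmul_dualComulFun ω t z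

theorem pairing_rmul_dualComul (ω : H.dual) (t : H.dual ⊗[ℂ] H.dual) (z : A ⊗[ℂ] A) :
    H.pairing ((H.dualComul ω).rmul t) z =
      (ω : Module.Dual ℂ A) (LinearMap.mul' ℂ A (H.actL₂ t z)) :=
  H.pairing_rmul_dualComulFun ω t z

end TensorActions

section Covers

variable {H} {ω ω' : H.dual} {t : H.dual ⊗[ℂ] H.dual}

/-- Identifies a covered `Δ̂(ω)` by its pairing: after multiplication by `s`, both sides pair as `ω
∘ μ` on the acted tensor, by the module law. -/
theorem dualComul_mul_leg₁ (ht : ∀ x y, H.pairing t (x ⊗ₜ[ℂ] y) =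
    (ω : Module.Dual ℂ A) (H.actR ω' x * y)) : H.dualComul ω * leg₁ ω' = ofElem t := by
  refine ext_lmul fun s => H.pairing_ext fun x y => ?_
  rw [lmul_mul_apply, lmul_ofElem, pairing_lmul_dualComul, pairing_mul_actR₂]
  induction s with
  | zero => simp
  | add s s' h h' => simp only [map_add, LinearMap.add_apply, h, h']
  | tmul p q => simp [ht, actR_mul_apply]

theorem dualComul_mul_leg₂ (ht : ∀ x y, H.pairing t (x ⊗ₜ[ℂ] y) =
    (ω : Module.Dual ℂ A) (x * H.actR ω' y)) : H.dualComul ω * leg₂ ω' = ofElem t := by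
  refine ext_lmul fun s => H.pairing_ext fun x y => ?_
  rw [lmul_mul_apply, lmul_ofElem, pairing_lmul_dualComul, pairing_mul_actR₂]
  induction s with
  | zero => simp
  | add s s' h h' => simp only [map_add, LinearMap.add_apply, h, h']
  | tmul p q => simp [ht, actR_mul_apply]

theorem leg₁_mul_dualComul (ht : ∀ x y, H.pairing t (x ⊗ₜ[ℂ] y) =
    (ω : Module.Dual ℂ A) (H.actL ω' x * y)) : leg₁ ω' * H.dualComul ω = ofElem t := by
  refine ext_rmul fun s => H.pairing_ext fun x y => ?_
  rw [rmul_mul_apply, rmul_ofElem, pairing_rmul_dualComul, pairing_mul_actL₂]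
  induction s with
  | zero => simp
  | add s s' h h' => simp only [map_add, LinearMap.add_apply, h, h']
  | tmul p q => simp [ht, actL_mul_apply]

theorem leg₂_mul_dualComul (ht : ∀ x y, H.pairing t (x ⊗ₜ[ℂ] y) =
    (ω : Module.Dual ℂ A) (x * H.actL ω' y)) : leg₂ ω' * H.dualComul ω = ofElem t := by
  refine ext_rmul fun s => H.pairing_ext fun x y => ?_
  rw [rmul_mul_apply, rmul_ofElem, pairing_rmul_dualComul, pairing_mul_actL₂]
  induction s with
  | zero => simp
  | add s s' h h' => simp only [map_add, LinearMap.add_apply, h, h']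
  | tmul p q => simp [ht, actL_mul_apply]

end Covers

/-- The comultiplication of `Â` is regular. -/
def dualPreComul : PreComul H.dual where
  nondeg := H.instNondegMulDual
  comul := H.dualComul
  mem_mul_leg₁ ω ω' := (H.exists_pairing_right₁ ω ω').imp fun _ => dualComul_mul_leg₁
  mem_mul_leg₂ ω ω' := (H.exists_pairing_right₂ ω ω').imp fun _ => dualComul_mul_leg₂
  mem_leg₁_mul ω ω' := (H.exists_pairing_left₁ ω ω').imp fun _ => leg₁_mul_dualComul
  mem_leg₂_mul ω ω' := (H.exists_pairing_left₂ ω ω').imp fun _ => leg₂_mul_dualComul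

theorem pairing_dual_comulR₁ (ω ω' : H.dual) (x y : A) :
    H.pairing (H.dualPreComul.comulR₁ ω ω') (x ⊗ₜ[ℂ] y) =
      (ω : Module.Dual ℂ A) (H.actR ω' x * y) := by
  obtain ⟨t, ht⟩ := H.exists_pairing_right₁ ω ω'
  rw [← ht, ofElem_injective
    ((H.dualPreComul.ofElem_comulR₁ ω ω').trans (dualComul_mul_leg₁ ht))]

theorem pairing_dual_comulR₂ (ω ω' : H.dual) (x y : A) :
    H.pairing (H.dualPreComul.comulR₂ ω ω') (x ⊗ₜ[ℂ] y) =
      (ω : Module.Dual ℂ A) (x * H.actR ω' y) := by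
  obtain ⟨t, ht⟩ := H.exists_pairing_right₂ ω ω'
  rw [← ht, ofElem_injective
    ((H.dualPreComul.ofElem_comulR₂ ω ω').trans (dualComul_mul_leg₂ ht))]

theorem pairing_dual_comulL₁ (ω ω' : H.dual) (x y : A) :
    H.pairing (H.dualPreComul.comulL₁ ω ω') (x ⊗ₜ[ℂ] y) =
      (ω : Module.Dual ℂ A) (H.actL ω' x * y) := by
  obtain ⟨t, ht⟩ := H.exists_pairing_left₁ ω ω'
  rw [← ht, ofElem_injective
    ((H.dualPreComul.ofElem_comulL₁ ω ω').trans (leg₁_mul_dualComul ht))]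

theorem pairing_dual_comulL₂ (ω ω' : H.dual) (x y : A) :
    H.pairing (H.dualPreComul.comulL₂ ω ω') (x ⊗ₜ[ℂ] y) =
      (ω : Module.Dual ℂ A) (x * H.actL ω' y) := by
  obtain ⟨t, ht⟩ := H.exists_pairing_left₂ ω ω'
  rw [← ht, ofElem_injective
    ((H.dualPreComul.ofElem_comulL₂ ω ω').trans (leg₂_mul_dualComul ht))]

end QuantumHypergroup

/-! ### The dual hypergroup. -/

namespace QuantumHypergroup

open Multiplier

section Uniqueness

variable {B : Type*} [NonUnitalRing B] [Module ℂ B] [IsScalarTower ℂ B B] [SMulCommClass ℂ B B]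

theorem ext_of_data {D D' : QuantumHypergroup B} (hΔ : D.comul = D'.comul) (hε : D.ε = D'.ε)
    (hφ : D.φ = D'.φ) (hS : D.S = D'.S) : D = D' := by
  rcases D with ⟨⟨_, _, _, _, _, _⟩, _, _, _, _, _, _, _, _, _, _, _, _⟩
  rcases D' with ⟨⟨_, _, _, _, _, _⟩, _, _, _, _, _, _, _, _, _, _, _, _⟩
  dsimp only at hΔ hε hφ hS
  subst hΔ hε hφ hS
  rfl

end Uniqueness

variable {A : Type*} [NonUnitalRing A] [Module ℂ A] [IsScalarTower ℂ A A] [SMulCommClass ℂ A A]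
  (H : QuantumHypergroup A)

section DualSlices

variable (ω ω' : H.dual) (x y : A)

/-- Slicing with an evaluation turns `Δ̂` into a shift of the argument by the product of `A`. As
evaluations separate `Â`, these formulas suffice for checking the axioms. -/
theorem sliceR_ev_comulR₂ : sliceR (H.ev y) (H.dualPreComul.comulR₂ ω ω') =
    H.smulL (H.actR ω' y) ω :=
  H.dual_ext fun x => by rw [sliceR_ev_apply, pairing_dual_comulR₂, smulL_apply]

theorem sliceL_ev_comulR₂ : sliceL (H.ev x) (H.dualPreComul.comulR₂ ω ω') =
    H.smulR x ω * ω' :=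
  H.dual_ext fun y => by rw [sliceL_ev_apply, pairing_dual_comulR₂, mul_apply_actR, smulR_apply]

theorem sliceL_ev_comulR₁ : sliceL (H.ev x) (H.dualPreComul.comulR₁ ω ω') =
    H.smulR (H.actR ω' x) ω :=
  H.dual_ext fun y => by rw [sliceL_ev_apply, pairing_dual_comulR₁, smulR_apply]

theorem sliceL_ev_comulL₁ : sliceL (H.ev x) (H.dualPreComul.comulL₁ ω ω') =
    H.smulR (H.actL ω' x) ω :=
  H.dual_ext fun y => by rw [sliceL_ev_apply, pairing_dual_comulL₁, smulR_apply]

theorem sliceR_ev_comulL₂ : sliceR (H.ev y) (H.dualPreComul.comulL₂ ω ω') =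
    H.smulL (H.actL ω' y) ω :=
  H.dual_ext fun x => by rw [sliceR_ev_apply, pairing_dual_comulL₂, smulL_apply]

theorem sliceL_ev_comulL₂ : sliceL (H.ev x) (H.dualPreComul.comulL₂ ω ω') =
    ω' * H.smulR x ω :=
  H.dual_ext fun y => by rw [sliceL_ev_apply, pairing_dual_comulL₂, mul_apply_actL, smulR_apply]

end DualSlices

/-- Paired with `x ⊗ y ⊗ z`, the two sides are `ω` of `(x' y) z'` and `x' (y z')`, where `x'` and
`z'` are the actions of `ω₁` on `x` and of `ω₃` on `z`. -/
theorem dualPreComul_coassoc (ω₁ ω ω₃ : H.dual) : TensorProduct.assoc ℂ H.dual H.dual H.dual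
      ((H.dualPreComul.comulL₁.flip ω₁).rTensor H.dual (H.dualPreComul.comulR₂ ω ω₃)) =
    (H.dualPreComul.comulR₂.flip ω₃).lTensor H.dual (H.dualPreComul.comulL₁ ω ω₁) := by
  let Q : H.dual ⊗[ℂ] (H.dual ⊗[ℂ] H.dual) →ₗ[ℂ] Module.Dual ℂ (A ⊗[ℂ] (A ⊗[ℂ] A)) :=
    TensorProduct.dualDistrib ℂ A (A ⊗[ℂ] A) ∘ₗ TensorProduct.map H.dual.subtype H.pairing
  have hQ : Function.Injective Q :=
    dualDistrib_map_injective H.dual.subtype_injective H.pairing_injective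
  have hQt : ∀ ω t x z, Q (ω ⊗ₜ[ℂ] t) (x ⊗ₜ[ℂ] z) = (ω : Module.Dual ℂ A) x * H.pairing t z := by
    intro ω t x z
    simp [Q]
  have h1 : ∀ s ω x y z, Q (TensorProduct.assoc ℂ H.dual H.dual H.dual (s ⊗ₜ[ℂ] ω))
      (x ⊗ₜ[ℂ] (y ⊗ₜ[ℂ] z)) = H.pairing s (x ⊗ₜ[ℂ] y) * (ω : Module.Dual ℂ A) z := by
    intro s ω x y z
    induction s with
    | zero => simp
    | add s t hs ht =>
      simp only [TensorProduct.add_tmul, map_add, LinearMap.add_apply, hs, ht, add_mul]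
    | tmul p q =>
      rw [TensorProduct.assoc_tmul, hQt, pairing_tmul, pairing_tmul, mul_assoc]
  have h2 : ∀ t x y z, Q (TensorProduct.assoc ℂ H.dual H.dual H.dual
      ((H.dualPreComul.comulL₁.flip ω₁).rTensor H.dual t)) (x ⊗ₜ[ℂ] (y ⊗ₜ[ℂ] z)) =
      H.pairing t ((H.actL ω₁ x * y) ⊗ₜ[ℂ] z) := by
    intro t x y z
    induction t with
    | zero => simp
    | add s t hs ht => simp only [map_add, LinearMap.add_apply, hs, ht]
    | tmul p q =>
      rw [LinearMap.rTensor_tmul, h1, LinearMap.flip_apply, pairing_dual_comulL₁, pairing_tmul]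
  have h3 : ∀ t x y z, Q ((H.dualPreComul.comulR₂.flip ω₃).lTensor H.dual t)
      (x ⊗ₜ[ℂ] (y ⊗ₜ[ℂ] z)) = H.pairing t (x ⊗ₜ[ℂ] (y * H.actR ω₃ z)) := by
    intro t x y z
    induction t with
    | zero => simp
    | add s t hs ht => simp only [map_add, LinearMap.add_apply, hs, ht]
    | tmul p q =>
      rw [LinearMap.lTensor_tmul, hQt, LinearMap.flip_apply, pairing_dual_comulR₂, pairing_tmul]
  refine hQ (TensorProduct.ext' fun x w => ?_)
  induction w with
  | zero => simp
  | add v w hv hw => simp only [TensorProduct.tmul_add, map_add, hv, hw]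
  | tmul y z => rw [h2, h3, pairing_dual_comulR₂, pairing_dual_comulL₁, mul_assoc]

/-- The counit of `Â` as a homomorphism. -/
def dualε : H.dual →ₙₐ[ℂ] ℂ where
  toFun := H.dualCounit
  map_smul' := H.dualCounit.map_smul
  map_zero' := H.dualCounit.map_zero
  map_add' := H.dualCounit.map_add
  map_mul' := H.dualCounit_mul

/-- The dual of an algebraic quantum hypergroup. -/
def dualHypergroup : QuantumHypergroup H.dual where
  toPreComul := H.dualPreComul
  coassoc := H.dualPreComul_coassoc
  ε := H.dualε
  counit_left ω := ext_lmul fun ω' => H.dual_ext fun y => by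
    change (sliceL H.dualCounit (H.dualPreComul.comulR₂ ω ω') : Module.Dual ℂ A) y = _
    rw [sliceL_apply, sliceR_ev_comulR₂, dualCounit_smulL, lmul_ofElem, mul_apply_actR]
  counit_right ω := ext_lmul fun ω' => H.dual_ext fun x => by
    change (sliceR H.dualCounit (H.dualPreComul.comulR₁ ω ω') : Module.Dual ℂ A) x = _
    rw [sliceR_apply, sliceL_ev_comulR₁, dualCounit_smulR, lmul_ofElem, mul_apply_actR]
  φ := H.dualφ
  φ_ne_zero h := by
    obtain ⟨e, he⟩ := H.exists_counit_eq_one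
    have h1 := H.dualφ_leftDualψ e
    rw [h, he] at h1
    exact zero_ne_one h1
  φ_left_invariant ω := ext_lmul fun ω' => H.dual_ext fun x => by
    rw [PreComul.lmul_mulSliceR, sliceR_apply, sliceL_ev_comulR₁, dualφ_smulR, counit_actR,
      lmul_smul, lmul_one]
    simp
  φ_faithful_left ω h := by
    obtain ⟨b, rfl⟩ := H.leftDualψ.surjective ω
    have hb : H.S.symm b = 0 := H.eq_of_dual fun ω => by
      rw [← dualφ_leftDualψ_mul, h, map_zero]
    simp at hb
    rw [hb, map_zero]
  φ_faithful_right ω h := H.dual_ext fun x => by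
    obtain ⟨c, rfl⟩ := H.S.symm.surjective x
    rw [← dualφ_leftDualψ_mul, h]
    simp
  S := H.dualS
  S_mul := H.dualS_mul
  -- For `ω = ψ(c ·)` both sides evaluate at `x` to `ω'(x S⁻¹(c))`.
  S_slice ω ω' := H.dual_ext fun x => by
    obtain ⟨c, rfl⟩ := H.leftDualψ.surjective ω
    rw [dualS_apply, sliceR_apply, sliceR_apply, sliceL_ev_comulR₂, sliceL_ev_comulL₂,
      smulR_leftDualψ, dualφ_leftDualψ_mul, dualφ_leftDualψ_mul, smulR_apply, S_symm_mul,
      LinearEquiv.symm_apply_apply]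

theorem isDual_dualHypergroup : H.IsDual H.dualHypergroup where
  comul_left ω₁ ω₂ x y := by
    refine (H.pairing_dual_comulL₁ ω₂ ω₁ x y).trans ?_
    obtain ⟨b, rfl⟩ := H.toDual.surjective ω₁
    have h : ∀ t, H.pairing (H.toDual b ⊗ₜ[ℂ] ω₂) t =
        (ω₂ : Module.Dual ℂ A) (sliceL (H.toDual b : Module.Dual ℂ A) t) := by
      intro t
      induction t with
      | zero => simp
      | add s t hs ht => simp only [map_add, hs, ht]
      | tmul p q => simp [pairing_tmul]
    rw [h, actL_toDual, H.sliceL_comulR₁_mul, coe_toDual]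
  comul_right ω₁ ω₂ x y := by
    refine (H.pairing_dual_comulR₂ ω₁ ω₂ x y).trans ?_
    have h : ∀ t, H.pairing (ω₁ ⊗ₜ[ℂ] ω₂) t =
        (ω₁ : Module.Dual ℂ A) (sliceR (ω₂ : Module.Dual ℂ A) t) := by
      intro t
      induction t with
      | zero => simp
      | add s t hs ht => simp only [map_add, hs, ht]
      | tmul p q => simp [pairing_tmul, mul_comm]
    rw [h, mul_actR]
  counit := H.dualCounit_toDual
  integral a ω h := by
    obtain rfl : ω = H.leftDualψ a := H.dual_ext fun x => by rw [h, leftDualψ_apply]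
    exact H.dualφ_leftDualψ a
  antipode := H.dualS_apply

/-! ### Uniqueness of the dual; multipliers as functionals. -/

variable {H}

/-- Left covers of the first leg determine `Δ̂`, and every `ω` has the forms `φ(· a)` and `ψ(a ·)`,
so the counit and integral formulas prescribe everything. -/
theorem IsDual.unique {D D' : QuantumHypergroup H.dual} (h : H.IsDual D) (h' : H.IsDual D') :
    D = D' := by
  refine ext_of_data (LinearMap.ext fun ω => ext_leg₁_mul fun ω' => ?_) ?_ ?_ ?_
  · rw [← D.ofElem_comulL₁, ← D'.ofElem_comulL₁]
    exact congrArg _ (H.pairing_ext fun x y => by rw [h.comul_left, h'.comul_left])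
  · ext ω
    obtain ⟨a, rfl⟩ := H.toDual.surjective ω
    rw [h.counit, h'.counit]
  · ext ω
    obtain ⟨a, rfl⟩ := H.leftDualψ.surjective ω
    rw [h.integral a _ (H.leftDualψ_apply a), h'.integral a _ (H.leftDualψ_apply a)]
  · ext ω
    rw [h.antipode, h'.antipode]

/-- A multiplier fixes its functional on the slices `(ι ⊗ φ)(Δ(a)(1 ⊗ b))`, and these are dense. -/
theorem IsFunctional.iff_eq {m : Multiplier H.dual} {f : Module.Dual ℂ A}
    (h : H.IsFunctional m f) (g : Module.Dual ℂ A) : H.IsFunctional m g ↔ g = f := by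
  refine ⟨fun hg => H.hom_ext_of_sliceR_φ fun a b => ?_, fun hg => hg ▸ h⟩
  rw [← H.leftConv_toDual, ← H.leftConv_toDual, ← (h _).1, ← (hg _).1]

/-- A character of an algebra is invariant under conjugation by an invertible multiplier. -/
theorem _root_.Multiplier.map_conj {χ : Module.Dual ℂ A} (hχ : ∀ a b, χ (a * b) = χ a * χ b)
    {e : A} (he : χ e = 1) (u : (Multiplier A)ˣ) (a : A) :
    χ (((u⁻¹ : (Multiplier A)ˣ) : Multiplier A).rmul ((u : Multiplier A).lmul a)) = χ a := by
  -- The character extends to `M(A)`: left and right multiplication by `m` both change `χ` by a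
  -- scalar, read off at `e`; for `u` and `u⁻¹` these scalars cancel.
  have h1 : ∀ m : Multiplier A, ∀ b, χ (m.lmul b) = χ (m.rmul e) * χ b := fun m b => by
    rw [← hχ, rmul_mul_eq, hχ, he, one_mul]
  have h2 : ∀ m : Multiplier A, ∀ b, χ (m.rmul b) = χ b * χ (m.lmul e) := fun m b => by
    rw [← hχ, ← rmul_mul_eq, hχ, he, mul_one]
  have h3 : χ ((u : Multiplier A).rmul e) *
      χ (((u⁻¹ : (Multiplier A)ˣ) : Multiplier A).lmul e) = 1 := by
    rw [← hχ, rmul_mul_eq, lmul_units_inv, hχ, he, one_mul]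
  rw [h2, h1, mul_right_comm, h3, one_mul]

/-! ### Modular data of the dual. -/

namespace ModularData

variable (M : H.ModularData)

theorem ψ_eq (y : A) : H.ψ y = H.φ ((M.δ : Multiplier A).rmul y) := M.φ_S y

theorem φ_eq (y : A) : H.φ y = H.ψ (((M.δ⁻¹ : (Multiplier A)ˣ) : Multiplier A).rmul y) := by
  rw [M.ψ_eq, rmul_units_inv]

/-- From `ψ = φ(· δ)`: the automorphisms differ by conjugation with `δ`, so any character agrees on
them. -/
theorem σ'_eq (a : A) : M.σ' a =
    ((M.δ⁻¹ : (Multiplier A)ˣ) : Multiplier A).rmul ((M.δ : Multiplier A).lmul (M.σ a)) := by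
  refine sub_eq_zero.1 (H.ψ_faithful_right _ fun b => ?_)
  rw [mul_sub, map_sub, ← M.ψ_mul, M.ψ_eq, M.ψ_eq, rmul_mul, rmul_mul, rmul_units_inv, M.φ_mul,
    rmul_mul_eq, sub_self]

theorem counit_σ' (a : A) : H.counit (M.σ' a) = H.counit (M.σ a) := by
  obtain ⟨e, he⟩ := H.exists_counit_eq_one
  rw [σ'_eq, map_conj H.counit_mul he]

theorem counit_σ_symm (b : A) : H.counit (M.σ.symm b) = H.counit (M.σ'.symm b) := by
  obtain ⟨e, he⟩ := H.exists_counit_eq_one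
  obtain ⟨a, rfl⟩ := M.σ.surjective b
  have h : ∀ a b, (H.counit ∘ₗ M.σ'.symm.toLinearMap) (a * b) =
      (H.counit ∘ₗ M.σ'.symm.toLinearMap) a * (H.counit ∘ₗ M.σ'.symm.toLinearMap) b := by
    intro a b
    have : M.σ'.symm (a * b) = M.σ'.symm a * M.σ'.symm b :=
      M.σ'.injective (by simp [M.σ'_mul])
    simp [this]
  -- Here the character is `ε ∘ σ'⁻¹`, which takes the value `1` at `σ'(e)`; the conjugate of `σ(a)`
  -- is `σ'(a)`.
  have h1 := map_conj h (e := M.σ' e) (by simpa using he) M.δ (M.σ a)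
  rw [← σ'_eq] at h1
  simpa using h1

/-- `S(δ⁻¹ b) = S(b) δ` -/
theorem S_lmul_inv (b : A) : H.S (((M.δ⁻¹ : (Multiplier A)ˣ) : Multiplier A).lmul b) =
    (M.δ : Multiplier A).rmul (H.S b) := by
  obtain ⟨e, he⟩ := H.exists_φ_eq_one
  obtain ⟨x, rfl⟩ := H.S.surjective e
  -- Both multipliers are slices of `Δ`, at `x` by `ψ` and at `S(x)` by `φ`, and the flip by `S`
  -- exchanges them.
  have h1 := congrArg (fun m : Multiplier A => m.lmul b) (M.ψ_slice x)
  have h2 := congrArg (fun m : Multiplier A => m.rmul (H.S b)) (M.φ_slice (H.S x))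
  simp only [ψ_apply, he, one_smul, PreComul.lmul_mulSliceR, PreComul.rmul_mulSliceL] at h1 h2
  rw [← h1, ← h2, comulL₂_S, sliceL_flipS]
  rfl

theorem S_symm_rmul (b : A) : H.S.symm ((M.δ : Multiplier A).rmul b) =
    ((M.δ⁻¹ : (Multiplier A)ˣ) : Multiplier A).lmul (H.S.symm b) := by
  rw [LinearEquiv.symm_apply_eq, S_lmul_inv, LinearEquiv.apply_symm_apply]

theorem smulL_leftDualψ (c a : A) :
    H.smulL c (H.leftDualψ a) = H.leftDualψ (M.σ'.symm c * a) := by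
  refine H.dual_ext fun x => ?_
  rw [smulL_apply, leftDualψ_apply, leftDualψ_apply, mul_assoc (M.σ'.symm c),
    M.ψ_mul (M.σ'.symm c), LinearEquiv.apply_symm_apply, mul_assoc]

theorem smulR_toDual (c a : A) : H.smulR c (H.toDual a) = H.toDual (a * M.σ c) := by
  refine H.dual_ext fun x => ?_
  rw [smulR_apply, toDual_apply, toDual_apply, mul_assoc, M.φ_mul, mul_assoc]

variable (N : H.dualHypergroup.ModularData)

theorem dual_ψ_toDual (a : A) : H.dualHypergroup.ψ (H.toDual a) = H.counit a := by
  obtain ⟨b, rfl⟩ := H.S.surjective a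
  exact (H.dualφ_leftDualψ b).trans (H.counit_S b).symm

theorem dual_ψ_mul_toDual (ω : H.dual) (a : A) :
    H.dualHypergroup.ψ (ω * H.toDual a) = (ω : Module.Dual ℂ A) (H.S.symm a) := by
  obtain ⟨b, rfl⟩ := H.S.surjective a
  change H.dualφ (H.dualS (ω * H.toDual (H.S b))) = _
  rw [dualS_mul]
  change H.dualφ (H.leftDualψ b * _) = _
  rw [dualφ_leftDualψ_mul, dualS_apply, LinearEquiv.apply_symm_apply, LinearEquiv.symm_apply_apply]

/-- With `ε(e) = 1`, `δ̂` is the slice of `Δ̂(ψ(e ·))` by `φ̂`. Shifting the argument of `ψ(e ·)` on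
the right by `c` gives `ψ(σ'⁻¹(c) e ·)`, on which `φ̂` is `ε(σ'⁻¹(c))`. -/
theorem isFunctional_dual_δ : H.IsFunctional (N.δ : Multiplier H.dual)
    (H.counit ∘ₗ M.σ'.symm.toLinearMap) := by
  obtain ⟨e, he⟩ := H.exists_counit_eq_one
  have h := N.φ_slice (H.leftDualψ e)
  change H.dualPreComul.mulSliceL H.dualφ _ = H.dualφ _ • _ at h
  rw [dualφ_leftDualψ, he, one_smul] at h
  refine fun ω => ⟨LinearMap.ext fun y => ?_, LinearMap.ext fun y => ?_⟩
  · rw [← h, PreComul.lmul_mulSliceL, sliceL_apply, sliceR_ev_comulR₂, M.smulL_leftDualψ,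
      dualφ_leftDualψ, counit_mul, he, mul_one]
    rfl
  · rw [← h, PreComul.rmul_mulSliceL, sliceL_apply, sliceR_ev_comulL₂, M.smulL_leftDualψ,
      dualφ_leftDualψ, counit_mul, he, mul_one]
    rfl

/-- Dually, `δ̂⁻¹` is the slice of `Δ̂(φ(· e))` by `ψ̂`, where `ψ̂(φ(· a)) = ε(a)` and a shift on
the left brings in `σ`. -/
theorem isFunctional_dual_δ_inv :
    H.IsFunctional ((N.δ⁻¹ : (Multiplier H.dual)ˣ) : Multiplier H.dual)
      (H.counit ∘ₗ M.σ.toLinearMap) := by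
  obtain ⟨e, he⟩ := H.exists_counit_eq_one
  have h := N.ψ_slice (H.toDual e)
  change H.dualPreComul.mulSliceR _ _ = _ at h
  rw [dual_ψ_toDual, he, one_smul] at h
  refine fun ω => ⟨LinearMap.ext fun x => ?_, LinearMap.ext fun x => ?_⟩
  · rw [← h, PreComul.lmul_mulSliceR, sliceR_apply, sliceL_ev_comulR₁, M.smulR_toDual,
      dual_ψ_toDual, counit_mul, he, one_mul]
    rfl
  · rw [← h, PreComul.rmul_mulSliceR, sliceR_apply, sliceL_ev_comulL₁, M.smulR_toDual,
      dual_ψ_toDual, counit_mul, he, one_mul]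
    rfl

/-- For `ω = ψ(d ·)`, computing `φ̂(ω ψ(S(a) ·))` in both orders gives `ψ(S(a) S⁻¹(d)) = φ(d
S²(a))`, and `φ = ψ(· δ⁻¹)` rewrites it through `ω`. -/
theorem dual_σ_apply (ω : H.dual) (a : A) : (N.σ ω : Module.Dual ℂ A) a =
    (ω : Module.Dual ℂ A) (((M.δ⁻¹ : (Multiplier A)ˣ) : Multiplier A).rmul (H.S (H.S a))) := by
  obtain ⟨d, rfl⟩ := H.leftDualψ.surjective ω
  have h : H.dualφ (H.leftDualψ d * H.leftDualψ (H.S a)) =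
      H.dualφ (H.leftDualψ (H.S a) * N.σ (H.leftDualψ d)) := N.φ_mul _ _
  rw [dualφ_leftDualψ_mul, dualφ_leftDualψ_mul, LinearEquiv.symm_apply_apply] at h
  rw [← h, leftDualψ_apply, leftDualψ_apply, ψ_mul_eq, LinearEquiv.apply_symm_apply, M.φ_eq,
    rmul_mul]

theorem dual_σ'_apply (ω : H.dual) (a : A) : (N.σ' ω : Module.Dual ℂ A) a =
    (ω : Module.Dual ℂ A)
      (((M.δ⁻¹ : (Multiplier A)ˣ) : Multiplier A).lmul (H.S.symm (H.S.symm a))) := by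
  obtain ⟨c, hc⟩ := H.toDual.surjective (N.σ' ω)
  -- The test element `S⁻¹(a) δ` is chosen so that `φ(· δ) = ψ` and then `ψ = φ ∘ S` give the value
  -- at `a` on one side, while `S⁻¹` moves `δ` to the left as `δ⁻¹` on the other.
  have h := N.ψ_mul ω (H.toDual ((M.δ : Multiplier A).rmul (H.S.symm a)))
  rw [← hc, dual_ψ_mul_toDual, dual_ψ_mul_toDual, toDual_apply, ← rmul_mul, ← M.ψ_eq,
    ← φ_mul_eq, ← toDual_apply, hc] at h
  rw [← h, S_symm_rmul]

end ModularData

end QuantumHypergroup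

end

theorem proposition4p1 {A : Type u} [NonUnitalRing A] [Module ℂ A] [IsScalarTower ℂ A A]
    [SMulCommClass ℂ A A] (H : QuantumHypergroup A) :
    (∃! D : QuantumHypergroup H.dual, H.IsDual D) ∧
    (Nonempty H.ModularData ∧ Subsingleton H.ModularData) ∧
    ∀ D : QuantumHypergroup H.dual, H.IsDual D →
      (Nonempty D.ModularData ∧ Subsingleton D.ModularData) ∧
      ∀ (M : H.ModularData) (N : D.ModularData),
        (∀ f : Module.Dual ℂ A, H.IsFunctional (N.δ : Multiplier H.dual) f ↔
          f = (H.ε : A →ₗ[ℂ] ℂ) ∘ₗ M.σ.symm.toLinearMap) ∧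
        (∀ f : Module.Dual ℂ A, H.IsFunctional (N.δ : Multiplier H.dual) f ↔
          f = (H.ε : A →ₗ[ℂ] ℂ) ∘ₗ M.σ'.symm.toLinearMap) ∧
        (∀ f : Module.Dual ℂ A,
          H.IsFunctional ((N.δ⁻¹ : (Multiplier H.dual)ˣ) : Multiplier H.dual) f ↔
          f = (H.ε : A →ₗ[ℂ] ℂ) ∘ₗ M.σ.toLinearMap) ∧
        (∀ f : Module.Dual ℂ A,
          H.IsFunctional ((N.δ⁻¹ : (Multiplier H.dual)ˣ) : Multiplier H.dual) f ↔
          f = (H.ε : A →ₗ[ℂ] ℂ) ∘ₗ M.σ'.toLinearMap) ∧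
        (∀ (ω : H.dual) (a : A), (N.σ ω : Module.Dual ℂ A) a =
          (ω : Module.Dual ℂ A)
            (((M.δ⁻¹ : (Multiplier A)ˣ) : Multiplier A).rmul (H.S (H.S a)))) ∧
        (∀ (ω : H.dual) (a : A), (N.σ' ω : Module.Dual ℂ A) a =
          (ω : Module.Dual ℂ A)
            (((M.δ⁻¹ : (Multiplier A)ˣ) : Multiplier A).lmul (H.S.symm (H.S.symm a)))) := by
  refine ⟨⟨H.dualHypergroup, H.isDual_dualHypergroup, fun D hD =>
    hD.unique H.isDual_dualHypergroup⟩, ⟨H.nonempty_modularData, H.subsingleton_modularData⟩,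
    fun D hD => ⟨⟨D.nonempty_modularData, D.subsingleton_modularData⟩, fun M N => ?_⟩⟩
  -- By uniqueness, `D` may be taken to be the constructed dual, whose structure maps are explicit.
  obtain rfl := hD.unique H.isDual_dualHypergroup
  have h1 : H.counit ∘ₗ M.σ.symm.toLinearMap = H.counit ∘ₗ M.σ'.symm.toLinearMap :=
    LinearMap.ext M.counit_σ_symm
  have h2 : H.counit ∘ₗ M.σ'.toLinearMap = H.counit ∘ₗ M.σ.toLinearMap :=
    LinearMap.ext M.counit_σ'
  refine ⟨?_, (M.isFunctional_dual_δ N).iff_eq, (M.isFunctional_dual_δ_inv N).iff_eq, ?_,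
    M.dual_σ_apply N, M.dual_σ'_apply N⟩
  · rw [h1]
    exact (M.isFunctional_dual_δ N).iff_eq
  · rw [h2]
    exact (M.isFunctional_dual_δ_inv N).iff_eq
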